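/- Let $(\mathcal G,\otimes,u)$ be an abelian symmetric monoidal category with $\otimes$ exact in both arguments which has inner cohomomorphism objects: for all $X,Z$ an object $\underline{\mathrm{cohom}}(X,Z)$ and a coevaluation $c_{X,Z}:X\to\underline{\mathrm{cohom}}(X,Z)\otimes Z$ inducing $\mathrm{Hom}(\underline{\mathrm{cohom}}(X,Z),Y)\cong\mathrm{Hom}(X,Y\otimes Z)$ for all $Y$. Let $\mathcal H=\mathrm{Ind}(\mathcal G)$ with the induced symmetric monoidal structure. Let $P$ be an ordinary symmetric operad (pasting along directed trees with one output and at least one input at each vertex) with values in $\mathcal H$ (for instance in $\mathcal G$), with $P(1)=u$, contraction of an edge at a vertex with one input being the canonical identification. Let $\Delta:P\to P\bigcirc P$, $(P\bigcirc P)(n)=P(n)\otimes P(n)$, be a symmetric (cocommutative) comultiplication, i.e. a morphism of operads invariant under the exchange of the two factors. For $P$-algebras $V,W$ in $\mathcal H$ let $V\otimes W$ be the $P$-algebra with structure maps $P(n)\otimes(V\otimes W)^{\otimes n}\to P(n)\otimes V^{\otimes n}\otimes P(n)\otimes W^{\otimes n}\to V\otimes W$ induced by $\Delta$. A $P$-algebra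 with presentation $\mathcal V$ is a $P$-algebra $V$ in $\mathcal H$ with an object $V_1$ of $\mathcal G$ and a morphism $i_V:V_1\to V$ in $\mathcal H$ such that the induced morphism $F_P(V_1)=\bigoplus_{n\ge1}P(n)\otimes_{\mathbf S_n}V_1^{\otimes n}\to V$ from the free $P$-algebra is an epimorphism. A morphism $\mathcal V\to\mathcal W$ is a morphism $V_1\to W_1$ together with a morphism of algebras $V\to W$, compatible with $i_V,i_W$. Let $\mathcal A,\mathcal B$ be $P$-algebras with presentation. Assume that the object $B$ of $\mathcal H$ is the union of its subobjects belonging to $\mathcal G$, in the sense that each morphism from an object of $\mathcal G$ to $B$ factors through a subobject of $B$ belonging to $\mathcal G$ (this is automatic if $B$ lies in $\mathcal G$, or if all objects of $\mathcal G$ are noetherian, e.g. if $\mathcal G$ is the category of finite-dimensional vector spaces). Let $\mathcal A\Rightarrow\mathcal B$ be the category of triples $(F,u,u_1)$, where $F$ is a $P$-algebra in $\mathcal H$, $u:A\to F\otimes B$ is a morphism of $P$-algebras and $u_1:A_1\to F\otimes B_1$ is a morphism in $\mathcal H$ with $u\circ i_A=(\mathrm{id}_F\otimes i_B)\circ u_1$;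 morphisms are the morphisms of $P$-algebras $F\to F'$ compatible with $u,u'$ and $u_1,u_1'$. Then: 1. $\mathcal A\Rightarrow\mathcal B$ has an initial object $(E,\delta,\delta_1)$, unique up to unique isomorphism. 2. $E$ has a presentation $\mathcal E$, $i_E:E_1\to E$, with $E_1=\underline{\mathrm{cohom}}(A_1,B_1)$ (taken in $\mathcal G$) and $\delta_1=(i_E\otimes\mathrm{id})\circ c_{A_1,B_1}$. 3. Let $\mathcal F$ be a $P$-algebra with presentation, $w:A_1\to F_1\otimes B_1$ a morphism in $\mathcal G$, and $u:A\to F\otimes B$ a morphism of $P$-algebras induced by $w$, i.e. such that $(F,u,(i_F\otimes\mathrm{id})\circ w)$ is an object of $\mathcal A\Rightarrow\mathcal B$. Then there is exactly one morphism of algebras with presentation $\mathcal E\to\mathcal F$ whose component $\varphi_1:E_1\to F_1$ satisfies $(\varphi_1\otimes\mathrm{id})\circ c_{A_1,B_1}=w$ and whose component $E\to F$ is the canonical morphism from the initial object. In other words, $\mathcal E$ is an inner cohomomorphism object of $\mathcal A$ and $\mathcal B$. -/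

import Mathlib

open CategoryTheory MonoidalCategory Limits

universe v u₁ u₂

namespace OperadCohom

/-! ### Bijections used to name the inputs of composite trees -/

/-- `S ⊔ (T ⊔ {*}) ≃ (S ⊔ T) ⊔ {*}`. -/
def sumOption (S T : Type) : S ⊕ Option T ≃ Option (S ⊕ T) where
  toFun
    | .inl s => some (.inl s)
    | .inr none => none
    | .inr (some t) => some (.inr t)
  invFun
    | none => .inr none
    | some (.inl s) => .inl s
    | some (.inr t) => .inr (some t)
  left_inv := by rintro (s | _ | t) <;> rfl
  right_inv := by rintro (_ | s | t) <;> rfl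

/-- `(S ⊔ {*}) ⊔ T ≃ (S ⊔ T) ⊔ {*}`. -/
def optionSum (S T : Type) : Option S ⊕ T ≃ Option (S ⊕ T) where
  toFun
    | .inl none => none
    | .inl (some s) => some (.inl s)
    | .inr t => some (.inr t)
  invFun
    | none => .inl none
    | some (.inl s) => .inl (some s)
    | some (.inr t) => .inr t
  left_inv := by rintro ((_ | s) | t) <;> rfl
  right_inv := by rintro (_ | s | t) <;> rfl

/-- The exchange of the two added points of `S ⊔ {*} ⊔ {*}`. -/
def optionSwap (S : Type) : Option (Option S) ≃ Option (Option S) where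
  toFun
    | none => some none
    | some none => none
    | some (some s) => some (some s)
  invFun
    | none => some none
    | some none => none
    | some (some s) => some (some s)
  left_inv := by rintro (_ | _ | s) <;> rfl
  right_inv := by rintro (_ | _ | s) <;> rfl

/-- `(S ⊔ T) ⊔ U ≃ (S ⊔ U) ⊔ T`. -/
def sumRightComm (S T U : Type) : (S ⊕ T) ⊕ U ≃ (S ⊕ U) ⊕ T where
  toFun
    | .inl (.inl s) => .inl (.inl s)
    | .inl (.inr t) => .inr t
    | .inr x => .inl (.inr x)
  invFun
    | .inl (.inl s) => .inl (.inl s)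
    | .inl (.inr x) => .inr x
    | .inr t => .inl (.inr t)
  left_inv := by rintro ((s | t) | x) <;> rfl
  right_inv := by rintro ((s | x) | t) <;> rfl

/-- `S ⊔ {*} ≃ S ⊔ {*}`, from the disjoint union with a one-point type to `Option`. -/
def sumUnit (S : Type) : S ⊕ Unit ≃ Option S where
  toFun
    | .inl s => some s
    | .inr _ => none
  invFun
    | none => .inr ()
    | some s => .inl s
  left_inv := by rintro (s | _) <;> rfl
  right_inv := by rintro (_ | s) <;> rfl

/-- The two one-point types `Unit` and `Option Empty`. -/
def unitOption : Unit ≃ Option Empty where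
  toFun _ := none
  invFun _ := ()
  left_inv _ := rfl
  right_inv := by rintro (_ | e); exacts [rfl, e.elim]

/-- The two one-point types `Unit` and `Fin 1`. -/
def unitFin : Unit ≃ Fin 1 where
  toFun _ := 0
  invFun _ := ()
  left_inv _ := rfl
  right_inv _ := Subsingleton.elim _ _

section

variable {C : Type u₁} [Category.{v} C] [MonoidalCategory C]

/-! ### Tensor powers -/

/-- The tensor power `V ⊗ ⋯ ⊗ V`, bracketed to the left. -/
@[reducible] def tpow (V : C) : ℕ → C
  | 0 => 𝟙_ C
  | n + 1 => tpow V n ⊗ V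

/-- Functoriality of the tensor power. -/
def tpowMap {V W : C} (f : V ⟶ W) : (n : ℕ) → (tpow V n ⟶ tpow W n)
  | 0 => 𝟙 (𝟙_ C)
  | n + 1 => tpowMap f n ⊗ₘ f

/-- Rebracketing `V^{⊗(m+n)} ≅ V^{⊗m} ⊗ V^{⊗n}`. -/
def tpowAdd (V : C) (m : ℕ) : (n : ℕ) → (tpow V (m + n) ≅ tpow V m ⊗ tpow V n)
  | 0 => (ρ_ (tpow V m)).symm
  | n + 1 => whiskerRightIso (tpowAdd V m n) V ≪≫ α_ (tpow V m) (tpow V n) V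

lemma tpowMap_id (V : C) : ∀ n : ℕ, tpowMap (𝟙 V) n = 𝟙 (tpow V n)
  | 0 => rfl
  | n + 1 => by simp [tpowMap, tpowMap_id V n]

lemma tpowMap_comp {U V W : C} (f : U ⟶ V) (g : V ⟶ W) : ∀ n : ℕ,
    tpowMap (f ≫ g) n = tpowMap f n ≫ tpowMap g n
  | 0 => by simp [tpowMap]
  | n + 1 => by simp [tpowMap, tpowMap_comp f g n]

lemma tensorHom_comp_whiskerLeft {X X' Y Y' Y'' : C} (f : X ⟶ X') (g : Y ⟶ Y') (h : Y' ⟶ Y'') :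
    (f ⊗ₘ g) ≫ X' ◁ h = f ⊗ₘ (g ≫ h) := by
  rw [← id_tensorHom, tensorHom_comp_tensorHom, Category.comp_id]

lemma whiskerLeft_comp_tensorHom {X X' Y Y' Y'' : C} (f : X ⟶ X') (g : Y ⟶ Y') (h : Y' ⟶ Y'') :
    X ◁ g ≫ (f ⊗ₘ h) = f ⊗ₘ (g ≫ h) := by
  rw [← id_tensorHom, tensorHom_comp_tensorHom, Category.id_comp]

lemma tensorHom_comp_whiskerLeft_assoc {X X' Y Y' Y'' K : C} (f : X ⟶ X') (g : Y ⟶ Y')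
    (h : Y' ⟶ Y'') (k : X' ⊗ Y'' ⟶ K) :
    (f ⊗ₘ g) ≫ X' ◁ h ≫ k = (f ⊗ₘ (g ≫ h)) ≫ k := by
  rw [← Category.assoc, tensorHom_comp_whiskerLeft]

lemma whiskerLeft_comp_tensorHom_assoc {X X' Y Y' Y'' K : C} (f : X ⟶ X') (g : Y ⟶ Y')
    (h : Y' ⟶ Y'') (k : X' ⊗ Y'' ⟶ K) :
    X ◁ g ≫ (f ⊗ₘ h) ≫ k = (f ⊗ₘ (g ≫ h)) ≫ k := by
  rw [← Category.assoc, whiskerLeft_comp_tensorHom]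

end

/-! ### Ordinary operads -/

/-- An ordinary (symmetric, unital) operad in a symmetric monoidal category: a functor `obj` on the
groupoid of directed corollas with one output and a finite *nonempty* set `S` of inputs, with the
maps `comp` given by grafting the output of a corolla `T` to the input `*` of a corolla `S ⊔ {*}` and
contracting the resulting edge.  Every contraction of an edge is of this form up to renaming the
inputs.  The two associativity axioms say that the order in which the two edges of a tree with three
vertices are contracted does not matter (a linear tree, and a tree with two branches).
The value on the corolla with one input is the unit object, and contracting an
edge one end of which carries this corolla is the canonical isomorphism. -/
structure Operad (C : Type u₁) [Category.{v} C] [MonoidalCategory C] [SymmetricCategory C] where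
  obj : (S : Type) → [Finite S] → [Nonempty S] → C
  map : ∀ {S T : Type} [Finite S] [Nonempty S] [Finite T] [Nonempty T],
    (S ≃ T) → (obj S ⟶ obj T)
  map_refl : ∀ (S : Type) [Finite S] [Nonempty S], map (Equiv.refl S) = 𝟙 (obj S)
  map_trans : ∀ {S T U : Type} [Finite S] [Nonempty S] [Finite T] [Nonempty T] [Finite U]
    [Nonempty U] (e : S ≃ T) (f : T ≃ U), map (e.trans f) = map e ≫ map f
  comp : ∀ (S T : Type) [Finite S] [Finite T] [Nonempty T],
    obj (Option S) ⊗ obj T ⟶ obj (S ⊕ T)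
  comp_natural : ∀ {S S' T T' : Type} [Finite S] [Finite S'] [Finite T] [Nonempty T] [Finite T']
    [Nonempty T'] (e : S ≃ S') (f : T ≃ T'),
    (map e.optionCongr ⊗ₘ map f) ≫ comp S' T' = comp S T ≫ map (Equiv.sumCongr e f)
  comp_assoc : ∀ (S T U : Type) [Finite S] [Finite T] [Finite U] [Nonempty U],
    (comp S (Option T) ≫ map (sumOption S T)) ▷ obj U ≫ comp (S ⊕ T) U ≫
        map (Equiv.sumAssoc S T U) =
      (α_ (obj (Option S)) (obj (Option T)) (obj U)).hom ≫
        obj (Option S) ◁ comp T U ≫ comp S (T ⊕ U)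
  comp_comm : ∀ (S T U : Type) [Finite S] [Finite T] [Nonempty T] [Finite U] [Nonempty U],
    (comp (Option S) T ≫ map (optionSum S T)) ▷ obj U ≫ comp (S ⊕ T) U ≫
        map (sumRightComm S T U) =
      (α_ (obj (Option (Option S))) (obj T) (obj U)).hom ≫
        (map (optionSwap S) ⊗ₘ (β_ (obj T) (obj U)).hom) ≫
        (α_ (obj (Option (Option S))) (obj U) (obj T)).inv ≫
        (comp (Option S) U ≫ map (optionSum S U)) ▷ obj T ≫ comp (S ⊕ U) T
  unit : 𝟙_ C ≅ obj Unit
  unit_comp : ∀ (T : Type) [Finite T] [Nonempty T],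
    (unit.hom ≫ map unitOption) ▷ obj T ≫ comp Empty T ≫ map (Equiv.emptySum Empty T) =
      (λ_ (obj T)).hom
  comp_unit : ∀ (S : Type) [Finite S],
    obj (Option S) ◁ unit.hom ≫ comp S Unit ≫ map (sumUnit S) = (ρ_ (obj (Option S))).hom

section

variable {C : Type u₁} [Category.{v} C] [MonoidalCategory C] [SymmetricCategory C]

/-- `P(m + 1) ⊗ P(n + 1) ⟶ P(m + n + 1)`: composition at the last input. The inputs of the result
are the first `m` inputs of the first factor, followed by those of the second factor. -/
def Operad.compLast (P : Operad C) (m n : ℕ) :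
    P.obj (Fin (m + 1)) ⊗ P.obj (Fin (n + 1)) ⟶ P.obj (Fin (m + n + 1)) :=
  P.map finSuccEquivLast ▷ P.obj (Fin (n + 1)) ≫ P.comp (Fin m) (Fin (n + 1)) ≫
    P.map (T := Fin (m + n + 1)) (finSumFinEquiv (m := m) (n := n + 1))

/-- A symmetric (cocommutative) comultiplication on an operad `P`: a morphism of operads from `P`
to its white product with itself, `(P ○ P)(S) = P(S) ⊗ P(S)` with componentwise structure,
which is invariant under the exchange of the two factors. -/
structure Operad.Comul (P : Operad C) where
  app : ∀ (S : Type) [Finite S] [Nonempty S], P.obj S ⟶ P.obj S ⊗ P.obj S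
  naturality : ∀ {S T : Type} [Finite S] [Nonempty S] [Finite T] [Nonempty T] (e : S ≃ T),
    P.map e ≫ app T = app S ≫ (P.map e ⊗ₘ P.map e)
  app_comp : ∀ (S T : Type) [Finite S] [Finite T] [Nonempty T],
    P.comp S T ≫ app (S ⊕ T) =
      (app (Option S) ⊗ₘ app T) ≫
        tensorμ (P.obj (Option S)) (P.obj (Option S)) (P.obj T) (P.obj T) ≫
        (P.comp S T ⊗ₘ P.comp S T)
  app_unit : P.unit.hom ≫ app Unit = (λ_ (𝟙_ C)).inv ≫ (P.unit.hom ⊗ₘ P.unit.hom)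
  symm : ∀ (S : Type) [Finite S] [Nonempty S],
    app S ≫ (β_ (P.obj S) (P.obj S)).hom = app S

/-! ### Permutation and regrouping of tensor powers -/

/-- The exchange of the neighbouring factors number `i` and `i + 1` of `V^{⊗(n+1)}`
(numbered from `0`). -/
def tpowSwap (V : C) : (n : ℕ) → Fin n → (tpow V (n + 1) ⟶ tpow V (n + 1))
  | 0, i => i.elim0
  | n + 1, i =>
    Fin.lastCases (motive := fun _ => (tpow V (n + 2) ⟶ tpow V (n + 2)))
      ((α_ (tpow V n) V V).hom ≫ tpow V n ◁ (β_ V V).hom ≫ (α_ (tpow V n) V V).inv)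
      (fun j => tpowSwap V n j ▷ V) i

/-- The canonical map `X ⊗ (Y ⊗ Z) ⟶ Y ⊗ (X ⊗ Z)`. -/
def leftComm (X Y Z : C) : X ⊗ (Y ⊗ Z) ⟶ Y ⊗ (X ⊗ Z) :=
  (α_ X Y Z).inv ≫ (β_ X Y).hom ▷ Z ≫ (α_ Y X Z).hom

/-- The regrouping `(V ⊗ W)^{⊗n} ⟶ V^{⊗n} ⊗ W^{⊗n}`. -/
def regroup (V W : C) : (n : ℕ) → (tpow (V ⊗ W) n ⟶ tpow V n ⊗ tpow W n)
  | 0 => (λ_ (𝟙_ C)).inv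
  | n + 1 => regroup V W n ▷ (V ⊗ W) ≫ tensorμ (tpow V n) (tpow W n) V W

lemma tpowSwap_last (V : C) (n : ℕ) : tpowSwap V (n + 1) (Fin.last n) =
    (α_ (tpow V n) V V).hom ≫ tpow V n ◁ (β_ V V).hom ≫ (α_ (tpow V n) V V).inv :=
  Fin.lastCases_last ..

lemma tpowSwap_castSucc (V : C) (n : ℕ) (j : Fin n) :
    tpowSwap V (n + 1) j.castSucc = tpowSwap V n j ▷ V :=
  Fin.lastCases_castSucc ..

lemma tpowSwap_natural {V W : C} (f : V ⟶ W) : ∀ (n : ℕ) (i : Fin n),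
    tpowSwap V n i ≫ tpowMap f (n + 1) = tpowMap f (n + 1) ≫ tpowSwap W n i
  | 0, i => i.elim0
  | n + 1, i => by
    induction i using Fin.lastCases with
    | last =>
      have h : tpow V n ◁ (β_ V V).hom ≫ (tpowMap f n ⊗ₘ f ⊗ₘ f) =
          (tpowMap f n ⊗ₘ f ⊗ₘ f) ≫ tpow W n ◁ (β_ W W).hom := by
        rw [← id_tensorHom, ← id_tensorHom, tensorHom_comp_tensorHom, tensorHom_comp_tensorHom,
          ← BraidedCategory.braiding_naturality, Category.id_comp, Category.comp_id]
      simp [tpowSwap_last, tpowMap, h]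
    | cast j =>
      have := tpowSwap_natural f n j
      rw [tpowSwap_castSucc, tpowSwap_castSucc]
      change _ ≫ (tpowMap f (n + 1) ⊗ₘ f) = (tpowMap f (n + 1) ⊗ₘ f) ≫ _
      rw [← tensorHom_id, ← tensorHom_id, tensorHom_comp_tensorHom, tensorHom_comp_tensorHom, this]
      simp

lemma regroup_natural {V V' W W' : C} (f : V ⟶ V') (g : W ⟶ W') : ∀ n : ℕ,
    tpowMap (f ⊗ₘ g) n ≫ regroup V' W' n = regroup V W n ≫ (tpowMap f n ⊗ₘ tpowMap g n)
  | 0 => by simp [tpowMap, regroup]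
  | n + 1 => by
    have := regroup_natural f g n
    simp only [tpowMap, regroup, Category.assoc]
    rw [← tensorμ_natural, ← tensorHom_id, ← tensorHom_id, tensorHom_comp_tensorHom_assoc,
      tensorHom_comp_tensorHom_assoc, this]
    simp

lemma tensorμ_braiding (X₁ X₂ Y₁ Y₂ : C) :
    (β_ (X₁ ⊗ X₂) (Y₁ ⊗ Y₂)).hom ≫ tensorμ Y₁ Y₂ X₁ X₂ =
      tensorμ X₁ X₂ Y₁ Y₂ ≫ ((β_ X₁ Y₁).hom ⊗ₘ (β_ X₂ Y₂).hom) := by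
  dsimp only [tensorμ]
  simp only [BraidedCategory.braiding_tensor_left_hom, BraidedCategory.braiding_tensor_right_hom]
  calc
    _ = 𝟙 _ ⊗≫ X₁ ◁ (β_ X₂ Y₁).hom ▷ Y₂ ⊗≫ (β_ X₁ Y₁).hom ▷ X₂ ▷ Y₂ ⊗≫
      (Y₁ ◁ X₁ ◁ (β_ X₂ Y₂).hom) ⊗≫ Y₁ ◁ ((β_ X₁ Y₂).hom ≫ (β_ Y₂ X₁).hom) ▷ X₂ ⊗≫ 𝟙 _ := by
        monoidal
    _ = _ := by
      rw [SymmetricCategory.symmetry]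
      simp only [MonoidalCategory.tensorHom_def]
      monoidal

lemma leftComm_natural {X X' Y Y' Z Z' : C} (f : X ⟶ X') (g : Y ⟶ Y') (h : Z ⟶ Z') :
    (f ⊗ₘ (g ⊗ₘ h)) ≫ leftComm X' Y' Z' = leftComm X Y Z ≫ (g ⊗ₘ (f ⊗ₘ h)) := by
  simp only [leftComm, Category.assoc]
  rw [associator_inv_naturality_assoc, ← tensorHom_id, tensorHom_comp_tensorHom_assoc,
    BraidedCategory.braiding_naturality, Category.comp_id, ← associator_naturality,
    ← tensorHom_id, tensorHom_comp_tensorHom_assoc, Category.id_comp]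

lemma leftComm_tensorμ (X₁ X₂ Y₁ Y₂ Z₁ Z₂ : C) :
    leftComm (X₁ ⊗ X₂) (Y₁ ⊗ Y₂) (Z₁ ⊗ Z₂) ≫ (Y₁ ⊗ Y₂) ◁ tensorμ X₁ X₂ Z₁ Z₂ ≫
        tensorμ Y₁ Y₂ (X₁ ⊗ Z₁) (X₂ ⊗ Z₂) =
      (X₁ ⊗ X₂) ◁ tensorμ Y₁ Y₂ Z₁ Z₂ ≫ tensorμ X₁ X₂ (Y₁ ⊗ Z₁) (Y₂ ⊗ Z₂) ≫
        (leftComm X₁ Y₁ Z₁ ⊗ₘ leftComm X₂ Y₂ Z₂) := by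
  rw [← cancel_epi (α_ (X₁ ⊗ X₂) (Y₁ ⊗ Y₂) (Z₁ ⊗ Z₂)).hom, ← tensor_associativity_assoc]
  simp only [leftComm, Category.assoc, Iso.hom_inv_id_assoc, ← tensor_associativity]
  rw [← comp_whiskerRight_assoc, tensorμ_braiding, comp_whiskerRight_assoc,
    ← tensorHom_id, tensorμ_natural_left_assoc]
  simp

lemma regroup_swap (V W : C) : ∀ (n : ℕ) (i : Fin n),
    tpowSwap (V ⊗ W) n i ≫ regroup V W (n + 1) =
      regroup V W (n + 1) ≫ (tpowSwap V n i ⊗ₘ tpowSwap W n i)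
  | 0, i => i.elim0
  | n + 1, i => by
    induction i using Fin.lastCases with
    | last =>
      simp only [tpowSwap_last]
      change _ ≫ (regroup V W n ▷ (V ⊗ W) ≫ tensorμ _ _ _ _) ▷ (V ⊗ W) ≫ tensorμ _ _ _ _ =
        ((regroup V W n ▷ (V ⊗ W) ≫ tensorμ _ _ _ _) ▷ (V ⊗ W) ≫ tensorμ _ _ _ _) ≫ _
      have h : ∀ T U : C, ((α_ (T ⊗ U) (V ⊗ W) (V ⊗ W)).hom ≫
          (T ⊗ U) ◁ (β_ (V ⊗ W) (V ⊗ W)).hom ≫ (α_ (T ⊗ U) (V ⊗ W) (V ⊗ W)).inv) ≫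
          tensorμ T U V W ▷ (V ⊗ W) ≫ tensorμ (T ⊗ V) (U ⊗ W) V W =
          tensorμ T U V W ▷ (V ⊗ W) ≫ tensorμ (T ⊗ V) (U ⊗ W) V W ≫
          (((α_ T V V).hom ≫ T ◁ (β_ V V).hom ≫ (α_ T V V).inv) ⊗ₘ
            ((α_ U W W).hom ≫ U ◁ (β_ W W).hom ≫ (α_ U W W).inv)) := by
        intro T U
        have e : tensorμ T U V W ▷ (V ⊗ W) ≫ tensorμ (T ⊗ V) (U ⊗ W) V W =
            (α_ (T ⊗ U) (V ⊗ W) (V ⊗ W)).hom ≫ (T ⊗ U) ◁ tensorμ V W V W ≫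
              tensorμ T U (V ⊗ V) (W ⊗ W) ≫ ((α_ T V V).inv ⊗ₘ (α_ U W W).inv) := by
          rw [← tensor_associativity_assoc]
          simp
        rw [← tensorHom_comp_tensorHom, tensor_associativity_assoc, Category.assoc,
          Category.assoc, e, Iso.inv_hom_id_assoc, ← whiskerLeft_comp_assoc, tensorμ_braiding,
          whiskerLeft_comp_assoc, tensorμ_natural_right_assoc, tensorHom_comp_tensorHom]
      have h' := h (tpow V n) (tpow W n)
      simp only [comp_whiskerRight, Category.assoc] at h' ⊢
      rw [← associator_inv_naturality_left_assoc, whisker_exchange_assoc,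
        ← associator_naturality_left_assoc, h']
    | cast j =>
      have := regroup_swap V W n j
      rw [tpowSwap_castSucc, tpowSwap_castSucc, tpowSwap_castSucc]
      change _ ≫ regroup V W (n + 1) ▷ _ ≫ _ = (regroup V W (n + 1) ▷ _ ≫ _) ≫ _
      rw [← comp_whiskerRight_assoc, this, comp_whiskerRight_assoc, tensorμ_natural_left,
        Category.assoc]

lemma regroup_add (V W : C) (m : ℕ) : ∀ n : ℕ,
    (tpowAdd (V ⊗ W) m n).hom ≫ (regroup V W m ⊗ₘ regroup V W n) ≫
        tensorμ (tpow V m) (tpow W m) (tpow V n) (tpow W n) =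
      regroup V W (m + n) ≫ ((tpowAdd V m n).hom ⊗ₘ (tpowAdd W m n).hom)
  | 0 => by
    change (ρ_ (tpow (V ⊗ W) m)).inv ≫ (regroup V W m ⊗ₘ (λ_ (𝟙_ C)).inv) ≫ _ =
      regroup V W m ≫ ((ρ_ (tpow V m)).inv ⊗ₘ (ρ_ (tpow W m)).inv)
    have h : (ρ_ (tpow V m ⊗ tpow W m)).inv ≫ (tpow V m ⊗ tpow W m) ◁ (λ_ (𝟙_ C)).inv ≫
        tensorμ (tpow V m) (tpow W m) (𝟙_ C) (𝟙_ C) =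
        (ρ_ (tpow V m)).inv ⊗ₘ (ρ_ (tpow W m)).inv := by
      rw [Iso.inv_comp_eq, tensor_right_unitality]
      simp
    rw [MonoidalCategory.tensorHom_def, Category.assoc, ← rightUnitor_inv_naturality_assoc, h]
  | n + 1 => by
    have h := regroup_add V W m n
    change ((tpowAdd (V ⊗ W) m n).hom ▷ (V ⊗ W) ≫ (α_ _ _ _).hom) ≫
      (regroup V W m ⊗ₘ (regroup V W n ▷ (V ⊗ W) ≫ tensorμ _ _ _ _)) ≫ tensorμ _ _ _ _ =
      (regroup V W (m + n) ▷ (V ⊗ W) ≫ tensorμ _ _ _ _) ≫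
      (((tpowAdd V m n).hom ▷ V ≫ (α_ _ _ _).hom) ⊗ₘ ((tpowAdd W m n).hom ▷ W ≫ (α_ _ _ _).hom))
    rw [← tensorHom_comp_tensorHom]
    simp only [Category.assoc]
    rw [← tensorμ_natural_left_assoc, ← comp_whiskerRight_assoc, ← h]
    simp only [comp_whiskerRight, Category.assoc]
    rw [tensor_associativity]
    congr 1
    have e : (regroup V W m ⊗ₘ regroup V W n) ▷ (V ⊗ W) ≫ (α_ _ _ _).hom =
        (α_ _ _ _).hom ≫ (regroup V W m ⊗ₘ regroup V W n ▷ (V ⊗ W)) := by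
      rw [← tensorHom_id, associator_naturality, tensorHom_id]
    rw [reassoc_of% e, ← id_tensorHom, tensorHom_comp_tensorHom_assoc, Category.comp_id]

/-! ### Algebras over an operad -/

/-- An algebra over the operad `P`: an object `X` with structure maps `P(n) ⊗ X^{⊗n} ⟶ X`, `n ≥ 1`,
which are equivariant (it is enough to say this for the transpositions of neighbours, which generate
the symmetric group), unital and compatible with the composition of `P` (it is enough to say this
for the composition at the last input, the other inputs being covered by equivariance). -/
structure Alg (P : Operad C) where
  X : C
  act : ∀ n : ℕ, P.obj (Fin (n + 1)) ⊗ tpow X (n + 1) ⟶ X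
  act_swap : ∀ (n : ℕ) (i : Fin n),
    P.map (Equiv.swap i.castSucc i.succ) ▷ tpow X (n + 1) ≫ act n =
      P.obj (Fin (n + 1)) ◁ tpowSwap X n i ≫ act n
  act_unit : ((P.unit.hom ≫ P.map unitFin) ⊗ₘ (λ_ X).inv) ≫ act 0 = (λ_ X).hom
  act_comp : ∀ m n : ℕ,
    P.compLast m n ▷ tpow X (m + n + 1) ≫ act (m + n) =
      (α_ (P.obj (Fin (m + 1))) (P.obj (Fin (n + 1))) (tpow X (m + n + 1))).hom ≫
        P.obj (Fin (m + 1)) ◁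
          (P.obj (Fin (n + 1)) ◁ (tpowAdd X m (n + 1)).hom ≫
            leftComm (P.obj (Fin (n + 1))) (tpow X m) (tpow X (n + 1)) ≫
            tpow X m ◁ act n) ≫
        act m

/-- Morphisms of algebras over `P`. -/
@[ext]
structure Alg.Hom {P : Operad C} (V W : Alg P) where
  hom : V.X ⟶ W.X
  act_hom : ∀ n : ℕ, V.act n ≫ hom = P.obj (Fin (n + 1)) ◁ tpowMap hom (n + 1) ≫ W.act n

/-- The category of algebras over `P`. -/
instance (P : Operad C) : Category (Alg P) where
  Hom := Alg.Hom
  id V := ⟨𝟙 V.X, fun n => by rw [tpowMap_id]; simp⟩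
  comp f g := ⟨f.hom ≫ g.hom, fun n => by
    rw [reassoc_of% f.act_hom, g.act_hom, tpowMap_comp, whiskerLeft_comp_assoc]⟩
  id_comp f := Alg.Hom.ext (Category.id_comp f.hom)
  comp_id f := Alg.Hom.ext (Category.comp_id f.hom)
  assoc f g h := Alg.Hom.ext (Category.assoc f.hom g.hom h.hom)

lemma Alg.id_hom {P : Operad C} (V : Alg P) : Alg.Hom.hom (𝟙 V) = 𝟙 V.X := rfl

lemma Alg.comp_hom {P : Operad C} {U V W : Alg P} (f : U ⟶ V) (g : V ⟶ W) :
    Alg.Hom.hom (f ≫ g) = Alg.Hom.hom f ≫ Alg.Hom.hom g := rfl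

lemma Operad.Comul.app_compLast {P : Operad C} (Δ : P.Comul) (m n : ℕ) :
    P.compLast m n ≫ Δ.app (Fin (m + n + 1)) =
      (Δ.app (Fin (m + 1)) ⊗ₘ Δ.app (Fin (n + 1))) ≫
        tensorμ (P.obj (Fin (m + 1))) (P.obj (Fin (m + 1))) (P.obj (Fin (n + 1)))
          (P.obj (Fin (n + 1))) ≫
        (P.compLast m n ⊗ₘ P.compLast m n) := by
  simp only [Operad.compLast, Category.assoc]
  rw [Δ.naturality, reassoc_of% Δ.app_comp, tensorHom_comp_tensorHom, ← tensorHom_id,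
    tensorHom_comp_tensorHom_assoc, Δ.naturality, Category.id_comp,
    ← tensorHom_comp_tensorHom (P.map finSuccEquivLast ⊗ₘ 𝟙 _) (P.map finSuccEquivLast ⊗ₘ 𝟙 _),
    ← tensorμ_natural_assoc, tensorHom_comp_tensorHom_assoc, id_tensorHom_id,
    Category.comp_id]

/-- The structure maps of the tensor product of two algebras, induced by the comultiplication. -/
def Operad.Comul.tensorAct {P : Operad C} (Δ : P.Comul) (V W : Alg P) (n : ℕ) :
    P.obj (Fin (n + 1)) ⊗ tpow (V.X ⊗ W.X) (n + 1) ⟶ V.X ⊗ W.X :=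
  (Δ.app (Fin (n + 1)) ⊗ₘ regroup V.X W.X (n + 1)) ≫
    tensorμ (P.obj (Fin (n + 1))) (P.obj (Fin (n + 1))) (tpow V.X (n + 1)) (tpow W.X (n + 1)) ≫
    (V.act n ⊗ₘ W.act n)

/-- The tensor product of two algebras over an operad with comultiplication. -/
def Operad.Comul.tensor {P : Operad C} (Δ : P.Comul) (V W : Alg P) : Alg P where
  X := V.X ⊗ W.X
  act := Δ.tensorAct V W
  act_swap n i := by
    dsimp only [Operad.Comul.tensorAct]
    rw [← tensorHom_id, tensorHom_comp_tensorHom_assoc, Δ.naturality, Category.id_comp,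
      ← id_tensorHom, tensorHom_comp_tensorHom_assoc, Category.id_comp, regroup_swap,
      ← Category.comp_id (regroup V.X W.X (n + 1)), ← tensorHom_comp_tensorHom_assoc,
      tensorHom_id, tensorμ_natural_left_assoc, tensorHom_comp_tensorHom, V.act_swap, W.act_swap,
      ← tensorHom_comp_tensorHom, ← tensorμ_natural_right_assoc, ← id_tensorHom,
      tensorHom_comp_tensorHom_assoc, Category.comp_id, Category.comp_id]
  act_unit := by
    dsimp only [Operad.Comul.tensorAct]
    have h₁ : (P.unit.hom ≫ P.map unitFin) ≫ Δ.app (Fin (0 + 1)) = (λ_ (𝟙_ C)).inv ≫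
        ((P.unit.hom ≫ P.map unitFin) ⊗ₘ (P.unit.hom ≫ P.map unitFin)) := by
      rw [Category.assoc, Δ.naturality, reassoc_of% Δ.app_unit, tensorHom_comp_tensorHom]
    have h₂ : (λ_ (V.X ⊗ W.X)).inv ≫ regroup V.X W.X (0 + 1) =
        ((λ_ V.X).inv ⊗ₘ (λ_ W.X).inv) := by
      change _ ≫ (λ_ (𝟙_ C)).inv ▷ _ ≫ tensorμ _ _ _ _ = _
      rw [Iso.inv_comp_eq, tensor_left_unitality]
      simp
    rw [tensorHom_comp_tensorHom_assoc, h₁, h₂,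
      ← Category.id_comp ((λ_ V.X).inv ⊗ₘ (λ_ W.X).inv), ← tensorHom_comp_tensorHom_assoc,
      tensorμ_natural_assoc, tensorHom_comp_tensorHom, V.act_unit, W.act_unit, tensorHom_id,
      ← tensor_left_unitality]
  act_comp m n := by
    dsimp only [Operad.Comul.tensorAct]
    have h₁ : P.compLast m n ▷ tpow (V.X ⊗ W.X) (m + n + 1) ≫
        (Δ.app (Fin (m + n + 1)) ⊗ₘ regroup V.X W.X (m + n + 1)) =
        ((Δ.app (Fin (m + 1)) ⊗ₘ Δ.app (Fin (n + 1))) ⊗ₘ regroup V.X W.X (m + n + 1)) ≫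
          tensorμ (P.obj (Fin (m + 1))) (P.obj (Fin (m + 1))) (P.obj (Fin (n + 1)))
            (P.obj (Fin (n + 1))) ▷ (tpow V.X (m + n + 1) ⊗ tpow W.X (m + n + 1)) ≫
          (P.compLast m n ⊗ₘ P.compLast m n) ▷
            (tpow V.X (m + n + 1) ⊗ tpow W.X (m + n + 1)) := by
      rw [← tensorHom_id, tensorHom_comp_tensorHom, Δ.app_compLast, ← tensorHom_id,
        ← tensorHom_id, tensorHom_comp_tensorHom, tensorHom_comp_tensorHom]
      simp
    have h₂ := regroup_add V.X W.X m (n + 1)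
    rw [reassoc_of% h₁, tensorμ_natural_left_assoc, tensorHom_comp_tensorHom, V.act_comp,
      W.act_comp, ← tensorHom_comp_tensorHom, tensor_associativity_assoc,
      associator_naturality_assoc]
    have h₃ : (Δ.app (Fin (n + 1)) ⊗ₘ regroup V.X W.X (m + n + 1)) ≫
        tensorμ (P.obj (Fin (n + 1))) (P.obj (Fin (n + 1))) (tpow V.X (m + n + 1))
          (tpow W.X (m + n + 1)) ≫
        ((P.obj (Fin (n + 1)) ◁ (tpowAdd V.X m (n + 1)).hom ≫
            leftComm (P.obj (Fin (n + 1))) (tpow V.X m) (tpow V.X (n + 1)) ≫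
              tpow V.X m ◁ V.act n) ⊗ₘ
          (P.obj (Fin (n + 1)) ◁ (tpowAdd W.X m (n + 1)).hom ≫
            leftComm (P.obj (Fin (n + 1))) (tpow W.X m) (tpow W.X (n + 1)) ≫
              tpow W.X m ◁ W.act n)) =
        (P.obj (Fin (n + 1)) ◁ (tpowAdd (V.X ⊗ W.X) m (n + 1)).hom ≫
          leftComm (P.obj (Fin (n + 1))) (tpow (V.X ⊗ W.X) m) (tpow (V.X ⊗ W.X) (n + 1)) ≫
            tpow (V.X ⊗ W.X) m ◁
              ((Δ.app (Fin (n + 1)) ⊗ₘ regroup V.X W.X (n + 1)) ≫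
                tensorμ (P.obj (Fin (n + 1))) (P.obj (Fin (n + 1))) (tpow V.X (n + 1))
                  (tpow W.X (n + 1)) ≫ (V.act n ⊗ₘ W.act n))) ≫ regroup V.X W.X (m + 1) := by
      change _ = _ ≫ regroup V.X W.X m ▷ (V.X ⊗ W.X) ≫ tensorμ _ _ _ _
      have e₁ : tpow (V.X ⊗ W.X) m ◁
              ((Δ.app (Fin (n + 1)) ⊗ₘ regroup V.X W.X (n + 1)) ≫
                tensorμ (P.obj (Fin (n + 1))) (P.obj (Fin (n + 1))) (tpow V.X (n + 1))
                  (tpow W.X (n + 1)) ≫ (V.act n ⊗ₘ W.act n)) ≫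
            regroup V.X W.X m ▷ (V.X ⊗ W.X) =
          (regroup V.X W.X m ⊗ₘ (Δ.app (Fin (n + 1)) ⊗ₘ regroup V.X W.X (n + 1))) ≫
            (tpow V.X m ⊗ tpow W.X m) ◁ tensorμ (P.obj (Fin (n + 1))) (P.obj (Fin (n + 1)))
              (tpow V.X (n + 1)) (tpow W.X (n + 1)) ≫
            (tpow V.X m ⊗ tpow W.X m) ◁ (V.act n ⊗ₘ W.act n) := by
        rw [← id_tensorHom, ← id_tensorHom, ← id_tensorHom, ← tensorHom_id,
          tensorHom_comp_tensorHom, tensorHom_comp_tensorHom, tensorHom_comp_tensorHom]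
        simp
      have e₂ : P.obj (Fin (n + 1)) ◁ (tpowAdd (V.X ⊗ W.X) m (n + 1)).hom ≫
            (Δ.app (Fin (n + 1)) ⊗ₘ (regroup V.X W.X m ⊗ₘ regroup V.X W.X (n + 1))) ≫
            (P.obj (Fin (n + 1)) ⊗ P.obj (Fin (n + 1))) ◁
              tensorμ (tpow V.X m) (tpow W.X m) (tpow V.X (n + 1)) (tpow W.X (n + 1)) =
          (Δ.app (Fin (n + 1)) ⊗ₘ regroup V.X W.X (m + n + 1)) ≫
            (P.obj (Fin (n + 1)) ⊗ P.obj (Fin (n + 1))) ◁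
              ((tpowAdd V.X m (n + 1)).hom ⊗ₘ (tpowAdd W.X m (n + 1)).hom) := by
        rw [← id_tensorHom, ← id_tensorHom, ← id_tensorHom, tensorHom_comp_tensorHom,
          tensorHom_comp_tensorHom, tensorHom_comp_tensorHom, h₂]
        simp only [Category.id_comp, Category.comp_id]
        rfl
      simp only [Category.assoc]
      rw [reassoc_of% e₁, ← reassoc_of% leftComm_natural, tensorμ_natural_right,
        reassoc_of% leftComm_tensorμ, reassoc_of% e₂, tensorμ_natural_right_assoc,
        tensorHom_comp_tensorHom, tensorHom_comp_tensorHom]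
    rw [← tensorHom_comp_tensorHom (P.obj (Fin (m + 1)) ◁ _) (P.obj (Fin (m + 1)) ◁ _),
      ← tensorμ_natural_right_assoc, tensorHom_comp_whiskerLeft_assoc,
      tensorHom_comp_whiskerLeft_assoc, whiskerLeft_comp_tensorHom_assoc, ← h₃]
    simp only [Category.assoc]

/-- Functoriality of the tensor product of algebras. -/
def Operad.Comul.tensorMap {P : Operad C} (Δ : P.Comul) {V V' W W' : Alg P} (f : V ⟶ V')
    (g : W ⟶ W') : Δ.tensor V W ⟶ Δ.tensor V' W' where
  hom := Alg.Hom.hom f ⊗ₘ Alg.Hom.hom g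
  act_hom n := by
    dsimp only [Operad.Comul.tensor, Operad.Comul.tensorAct]
    have e : P.obj (Fin (n + 1)) ◁ tpowMap (Alg.Hom.hom f ⊗ₘ Alg.Hom.hom g) (n + 1) ≫
        (Δ.app (Fin (n + 1)) ⊗ₘ regroup V'.X W'.X (n + 1)) =
        (Δ.app (Fin (n + 1)) ⊗ₘ regroup V.X W.X (n + 1)) ≫
          (P.obj (Fin (n + 1)) ⊗ P.obj (Fin (n + 1))) ◁
            (tpowMap (Alg.Hom.hom f) (n + 1) ⊗ₘ tpowMap (Alg.Hom.hom g) (n + 1)) := by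
      rw [← id_tensorHom, ← id_tensorHom, tensorHom_comp_tensorHom, tensorHom_comp_tensorHom,
        regroup_natural, Category.id_comp, Category.comp_id]
    rw [reassoc_of% e, tensorμ_natural_right_assoc, tensorHom_comp_tensorHom,
      ← Alg.Hom.act_hom f n, ← Alg.Hom.act_hom g n, ← tensorHom_comp_tensorHom, Category.assoc,
      Category.assoc]

lemma Operad.Comul.tensorMap_hom {P : Operad C} (Δ : P.Comul) {V V' W W' : Alg P} (f : V ⟶ V')
    (g : W ⟶ W') : Alg.Hom.hom (Δ.tensorMap f g) = Alg.Hom.hom f ⊗ₘ Alg.Hom.hom g := rfl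

/-! ### Free algebras and presentations -/

section

variable [HasCountableCoproducts C] [HasFiniteColimits C]

/-- The degree `n` part `P(n) ⊗_{S_n} V^{⊗n}` of the free algebra (`n` is written `n + 1`).  The
coinvariants are formed by identifying `p s ⊗ x` with `p ⊗ s x` for the transpositions `s` of
neighbours, which generate the symmetric group. -/
noncomputable def freeDeg (P : Operad C) (V : C) (n : ℕ) : C :=
  coequalizer
    (Sigma.desc fun i : Fin n =>
      P.map (Equiv.swap i.castSucc i.succ) ▷ tpow V (n + 1))
    (Sigma.desc fun i : Fin n => P.obj (Fin (n + 1)) ◁ tpowSwap V n i)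

/-- The object underlying the free algebra, `F_P(V) = ⨁_{n ≥ 1} P(n) ⊗_{S_n} V^{⊗n}`. -/
noncomputable def freeObj (P : Operad C) (V : C) : C := ∐ fun n : ℕ => freeDeg P V n

/-- The morphism `F_P(V) ⟶ A` which extends a morphism `i : V ⟶ A` to an algebra: on
`P(n) ⊗_{S_n} V^{⊗n}` it is induced by `P(n) ⊗ V^{⊗n} ⟶ P(n) ⊗ A^{⊗n} ⟶ A`. -/
noncomputable def freeDesc {P : Operad C} {V : C} (A : Alg P) (i : V ⟶ A.X) : freeObj P V ⟶ A.X :=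
  Sigma.desc fun n => coequalizer.desc (P.obj (Fin (n + 1)) ◁ tpowMap i (n + 1) ≫ A.act n) (by
    refine Sigma.hom_ext _ _ fun j => ?_
    rw [Sigma.ι_desc_assoc, Sigma.ι_desc_assoc, ← whisker_exchange_assoc, A.act_swap,
      ← whiskerLeft_comp_assoc, ← whiskerLeft_comp_assoc, tpowSwap_natural])

end

end

/-! ### Ground category and category of inductive limits -/

section

variable {G : Type u₁} [Category.{v} G] {H : Type u₂} [Category.{v} H]

/-- `ι : G ⥤ H` exhibits the monoidal category `H` as the category of inductive limits `Ind(G)`: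
`ι` is fully faithful, `H` has filtered colimits, they are preserved by the tensor product, the
objects of `G` are finitely presentable in `H`, and every object of `H` is a filtered colimit of
objects of `G`. (The tensor product of `H` is the extension of that of `G`, `ι` being monoidal.) -/
structure IsIndCompletion [MonoidalCategory H] (ι : G ⥤ H) : Prop where
  full : ι.Full
  faithful : ι.Faithful
  hasFilteredColimits : HasFilteredColimitsOfSize.{v, v} H
  tensorLeft_preserves : ∀ Y : H, PreservesFilteredColimitsOfSize.{v, v} (tensorLeft Y)
  presentable : ∀ X : G, IsFinitelyPresentable.{v} (ι.obj X)
  exists_colimit : ∀ Y : H, ∃ (J : Type v) (_ : SmallCategory J) (_ : IsFiltered J) (D : J ⥤ G)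
    (c : Cocone (D ⋙ ι)) (_ : IsColimit c), Nonempty (c.pt ≅ Y)

/-- The object `Y` of `Ind(G)` is the union of its subobjects which belong to `G`: every morphism
from an object of `G` to `Y` factors through such a subobject. -/
def IsUnionOfGround (ι : G ⥤ H) (Y : H) : Prop :=
  ∀ (X : G) (f : ι.obj X ⟶ Y), ∃ (Z : G) (g : ι.obj X ⟶ ι.obj Z) (h : ι.obj Z ⟶ Y),
    Mono h ∧ g ≫ h = f

/-- The inner cohomomorphism object: `Hom(cohom(X, Z), Y) = Hom(X, Y ⊗ Z)`. -/
noncomputable def cohom [MonoidalCategory G] (X Z : G) [(tensorRight Z).IsRightAdjoint] : G :=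
  (tensorRight Z).leftAdjoint.obj X

/-- The coevaluation morphism. -/
noncomputable def coev [MonoidalCategory G] (X Z : G) [(tensorRight Z).IsRightAdjoint] :
    X ⟶ cohom X Z ⊗ Z :=
  (Adjunction.ofIsRightAdjoint (tensorRight Z)).unit.app X

end

/-! ### Presentations and the category `𝓐 ⇒ 𝓑` -/

section

variable {G : Type u₁} [Category.{v} G] {H : Type u₂} [Category.{v} H]
  [MonoidalCategory H] [SymmetricCategory H]
  [HasCountableCoproducts H] [HasFiniteColimits H]

/-- An algebra with presentation: an algebra, an object of generators in the ground category and a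
morphism `incl` such that the corresponding morphism from the free algebra is surjective. -/
structure Presentation (ι : G ⥤ H) (P : Operad H) where
  gen : G
  alg : Alg P
  incl : ι.obj gen ⟶ alg.X
  epi : Epi (freeDesc alg incl)

/-- Morphisms of algebras with presentation: compatible morphisms of generators and of algebras. -/
structure Presentation.Hom {ι : G ⥤ H} {P : Operad H} (A B : Presentation ι P) where
  gen : A.gen ⟶ B.gen
  alg : A.alg ⟶ B.alg
  comm : A.incl ≫ Alg.Hom.hom alg = ι.map gen ≫ B.incl

/-- The objects `(F, u, u₁)` of the category `𝓐 ⇒ 𝓑`: commutative squares with sides `incl`,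
a morphism of algebras `u : A ⟶ F ⊗ B` and a morphism `u₁ : A₁ ⟶ F ⊗ B₁`. -/
structure CohomDiagram {ι : G ⥤ H} {P : Operad H} (Δ : P.Comul) (A B : Presentation ι P) where
  F : Alg P
  u : A.alg ⟶ Δ.tensor F B.alg
  u₁ : ι.obj A.gen ⟶ F.X ⊗ ι.obj B.gen
  comm : A.incl ≫ Alg.Hom.hom u = u₁ ≫ F.X ◁ B.incl

/-- The morphisms of `𝓐 ⇒ 𝓑`: morphisms of algebras `F ⟶ F'` inducing a morphism of squares. -/
@[ext]
structure CohomDiagram.Hom {ι : G ⥤ H} {P : Operad H} {Δ : P.Comul} {A B : Presentation ι P}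
    (D D' : CohomDiagram Δ A B) where
  f : D.F ⟶ D'.F
  comm : D.u ≫ Δ.tensorMap f (𝟙 B.alg) = D'.u
  comm₁ : D.u₁ ≫ Alg.Hom.hom f ▷ ι.obj B.gen = D'.u₁

/-- The category `𝓐 ⇒ 𝓑`. -/
instance {ι : G ⥤ H} {P : Operad H} (Δ : P.Comul) (A B : Presentation ι P) :
    Category (CohomDiagram Δ A B) where
  Hom := CohomDiagram.Hom
  id D := ⟨𝟙 D.F, by
      refine Alg.Hom.ext ?_
      rw [Alg.comp_hom, Operad.Comul.tensorMap_hom, Alg.id_hom, Alg.id_hom, id_tensorHom_id]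
      exact Category.comp_id _, by
      rw [Alg.id_hom, id_whiskerRight, Category.comp_id]⟩
  comp {D D' D''} a b := ⟨a.f ≫ b.f, by
      rw [← b.comm, ← a.comm]
      refine Alg.Hom.ext ?_
      simp only [Alg.comp_hom, Operad.Comul.tensorMap_hom, Alg.id_hom, Category.assoc]
      erw [tensorHom_comp_tensorHom]
      rw [Category.comp_id], by
      rw [← b.comm₁, ← a.comm₁, Alg.comp_hom, comp_whiskerRight, Category.assoc]⟩
  id_comp a := CohomDiagram.Hom.ext (Category.id_comp a.f)
  comp_id a := CohomDiagram.Hom.ext (Category.comp_id a.f)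
  assoc a b c := CohomDiagram.Hom.ext (Category.assoc a.f b.f c.f)

/-- For a presentation `𝓕` of `F` and `w : A₁ ⟶ F₁ ⊗ B₁`, the morphism `A₁ ⟶ F ⊗ B₁` which `w`
induces. -/
def inducedGen [MonoidalCategory G] {ι : G ⥤ H} [ι.Monoidal] {P : Operad H}
    {A B : Presentation ι P} (F : Presentation ι P) (w : A.gen ⟶ F.gen ⊗ B.gen) :
    ι.obj A.gen ⟶ F.alg.X ⊗ ι.obj B.gen :=
  ι.map w ≫ Functor.OplaxMonoidal.δ ι F.gen B.gen ≫ F.incl ▷ ι.obj B.gen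

end

end OperadCohom

open OperadCohom

/-!
# Inner cohomomorphism objects of algebras with presentation

Let `E₁ = cohom(A₁, B₁)`.  Since `E₁` is finitely presentable in `H`, its universal property extends
to all objects of `H` (`IsIndCompletion.indCoev_desc`): giving `u₁ : A₁ ⟶ F ⊗ B₁` is the same as
giving `e : E₁ ⟶ F`.  As `A` is generated by `A₁`, the morphism of algebras `u` is determined by
`u₁`, and it exists if and only if the extension of `A₁ ⟶ F ⊗ B` to monomials vanishes on the
kernel `K` of the morphism from the object `T(A₁)` of all monomials to `A` (`Alg.exists_hom_iff`).
The comultiplication of the operad yields a morphism `T(A₁) ⟶ T(E₁) ⊗ B` through which all these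
extensions factor (`preFreeTensor_desc`), so that the condition is that `T(E₁) ⟶ F` annihilates the
coefficients with respect to `B` of `K ⟶ T(E₁) ⊗ B`.  This is where the assumption on `B` enters:
`K` is a colimit of objects `K_j` of `G`, each `K_j ⟶ T(E₁) ⊗ B` factors through `T(E₁) ⊗ Z_j` for a
subobject `Z_j` of `B` in `G`, and its coefficients are a morphism `cohom(K_j, Z_j) ⟶ T(E₁)`.  That
`M ⊗ Z_j ⟶ M ⊗ B` is a monomorphism makes sure that no information is lost
(`IsIndCompletion.exists_coefficients`).  Hence the initial object is the algebra with generators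
`E₁` and these coefficients as relations (`IsIndCompletion.exists_universal`), and the other claims
are formal consequences of its universal property.

Algebras with generators and relations are constructed in `exists_alg_generators_relations` without
turning the free algebra into an algebra.  Instead, `T(V) = ⨁ P(n) ⊗ V^{⊗n}`, without coinvariants
under the symmetric groups, is given operations which lift those of every algebra generated by `V`
(`preFreeMul`).  These need not satisfy any axiom; the defects of the axioms are added to the list
of relations, and `T(V)` is divided by the ideal which all the relations generate (`idealHom`).
The operations descend to the quotient because the tensor product of `H` preserves finite colimits
and coproducts, which is derived from the right exactness of the tensor product of `G`.
-/

namespace OperadCohom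

/-! ### Ind-completions -/

section

variable {G : Type u₁} [Category.{v} G] {H : Type u₂} [Category.{v} H]

/-- The functor from the index category of a cocone to the category of objects of `G` over its
vertex. -/
@[simps]
def overVertex (ι : G ⥤ H) {J : Type v} [SmallCategory J] {D : J ⥤ G} {X : H}
    (c : D ⋙ ι ⟶ (Functor.const J).obj X) : J ⥤ CostructuredArrow ι X where
  obj j := CostructuredArrow.mk (Y := D.obj j) (c.app j)
  map u := CostructuredArrow.homMk (D.map u) (by simpa using c.naturality u)

/-- Morphisms from a finitely presentable object to a filtered colimit come from a stage of the
colimit, so that any presentation is cofinal among all objects of `G` over the colimit. -/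
lemma overVertex_final (ι : G ⥤ H) [ι.Full] [ι.Faithful]
    [∀ X, IsFinitelyPresentable.{v} (ι.obj X)]
    {J : Type v} [SmallCategory J] [IsFiltered J] {D : J ⥤ G} {X : H}
    {c : D ⋙ ι ⟶ (Functor.const J).obj X} (hc : IsColimit (Cocone.mk X c)) :
    (overVertex ι c).Final := by
  rw [Functor.final_iff_of_isFiltered]
  refine ⟨fun f => ?_, fun {f j} g₁ g₂ => ?_⟩
  · obtain ⟨j, g, hg⟩ := IsFinitelyPresentable.exists_hom_of_isColimit hc f.hom
    exact ⟨j, ⟨CostructuredArrow.homMk (ι.preimage g) (by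
      simpa [overVertex] using hg)⟩⟩
  · obtain ⟨k, a, b, h⟩ := IsFinitelyPresentable.exists_eq_of_isColimit hc (ι.map g₁.left)
      (ι.map g₂.left) ((CostructuredArrow.w g₁).trans (CostructuredArrow.w g₂).symm)
    refine ⟨_, a ≫ IsFiltered.coeqHom a b, ?_⟩
    ext
    let l₁ : f.left ⟶ D.obj j := g₁.left
    let l₂ : f.left ⟶ D.obj j := g₂.left
    change l₁ ≫ D.map _ = l₂ ≫ D.map _
    apply ι.map_injective
    have h' := congr($h ≫ ι.map (D.map (IsFiltered.coeqHom a b)))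
    simp only [Functor.comp_map, Category.assoc, ← Functor.map_comp] at h'
    rw [← IsFiltered.coeq_condition a b] at h'
    exact (ι.map_comp _ _).trans (h'.trans (ι.map_comp _ _).symm)

/-- Two parallel morphisms between filtered colimits of objects of `G` are colimits of levelwise
morphisms, over the category of all ways to represent both of them at some stages. -/
lemma exists_parallel_presentation (ι : G ⥤ H) [ι.Full] [ι.Faithful]
    [∀ X, IsFinitelyPresentable.{v} (ι.obj X)]
    {I J : Type v} [SmallCategory I] [SmallCategory J] [IsFiltered I] [IsFiltered J]
    {D : I ⥤ G} {D' : J ⥤ G} {X Y : H}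
    {c : D ⋙ ι ⟶ (Functor.const I).obj X} (hc : IsColimit (Cocone.mk X c))
    {c' : D' ⋙ ι ⟶ (Functor.const J).obj Y} (hc' : IsColimit (Cocone.mk Y c'))
    (f g : X ⟶ Y) :
    ∃ (K : Type v) (_ : SmallCategory K) (_ : IsFiltered K) (D₁ D₂ : K ⥤ G) (φ ψ : D₁ ⟶ D₂)
      (c₁ : D₁ ⋙ ι ⟶ (Functor.const K).obj X) (c₂ : D₂ ⋙ ι ⟶ (Functor.const K).obj Y)
      (_ : IsColimit (Cocone.mk X c₁)) (_ : IsColimit (Cocone.mk Y c₂)),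
      (∀ k, c₁.app k ≫ f = ι.map (φ.app k) ≫ c₂.app k) ∧
      (∀ k, c₁.app k ≫ g = ι.map (ψ.app k) ≫ c₂.app k) := by
  have h₂ := overVertex_final ι hc'
  let L := (overVertex ι c ⋙ CostructuredArrow.map f).prod'
    (overVertex ι c ⋙ CostructuredArrow.map g)
  let R := (overVertex ι c').prod' (overVertex ι c')
  have : R.Final :=
    inferInstanceAs (Functor.diag _ ⋙ (overVertex ι c').prod (overVertex ι c')).Final
  refine ⟨Comma L R, inferInstance, inferInstance, Comma.fst L R ⋙ D, Comma.snd L R ⋙ D',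
    { app := fun k => k.hom.1.left
      naturality := fun _ _ h => congr_arg (fun z => z.1.left) h.w },
    { app := fun k => k.hom.2.left
      naturality := fun _ _ h => congr_arg (fun z => z.2.left) h.w },
    Functor.whiskerLeft (Comma.fst L R) c, Functor.whiskerLeft (Comma.snd L R) c',
    (Functor.Final.isColimitWhiskerEquiv (Comma.fst L R) _).symm hc,
    (Functor.Final.isColimitWhiskerEquiv (Comma.snd L R) _).symm hc',
    fun k => (CostructuredArrow.w k.hom.1).symm, fun k => (CostructuredArrow.w k.hom.2).symm⟩

/-- A functor which preserves filtered colimits, and colimits of diagrams in `G`, preserves the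
colimits of filtered colimits of diagrams in `G`. -/
lemma preserves_of_levelwise (ι : G ⥤ H) {D : Type*} [Category.{v} D]
    [HasFilteredColimitsOfSize.{v, v} D] [HasFilteredColimitsOfSize.{v, v} H]
    {K : Type v} [SmallCategory K] [IsFiltered K] {J : Type} [SmallCategory J]
    [HasColimitsOfShape J G] [PreservesColimitsOfShape J ι]
    (F : H ⥤ D) [PreservesFilteredColimitsOfSize.{v, v} F]
    [PreservesColimitsOfShape J (ι ⋙ F)] (T : J ⥤ K ⥤ G) :
    PreservesColimit (T ⋙ (Functor.whiskeringRight K G H).obj ι ⋙ colim) F := by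
  let Φ := (Functor.whiskeringRight K G H).obj ι ⋙ colim
  let Φ' := (Functor.whiskeringRight K G D).obj (ι ⋙ F) ⋙ colim
  have h₁ : PreservesColimitsOfShape J Φ := inferInstance
  have h₂ : PreservesColimitsOfShape J Φ' := inferInstance
  let e : Φ' ≅ Φ ⋙ F :=
    NatIso.ofComponents (fun A => (preservesColimitIso F (A ⋙ ι)).symm) (by
      intro A B f
      refine colimit.hom_ext fun k => ?_
      have h (A : K ⥤ G) : colimit.ι (A ⋙ ι ⋙ F) k ≫ (preservesColimitIso F (A ⋙ ι)).inv =
          F.map (colimit.ι (A ⋙ ι) k) := ι_preservesColimitIso_inv F (A ⋙ ι) k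
      simp [Φ, Φ', h, reassoc_of% h A, ← Functor.map_comp])
  have h₃ : PreservesColimitsOfShape J (Φ ⋙ F) := preservesColimitsOfShape_of_natIso e
  exact preservesColimit_of_preserves_colimit_cocone
    (isColimitOfPreserves Φ (colimit.isColimit T))
    (isColimitOfPreserves (Φ ⋙ F) (colimit.isColimit T))

/-- A coproduct is the filtered colimit of the coproducts over finite subsets of its index set. -/
lemma preservesCoproduct_of_finite_of_filtered [HasColimits H] (F : H ⥤ H)
    [PreservesFilteredColimitsOfSize.{v, v} F] [PreservesFiniteColimits F] {S : Type v}
    (Y : S → H) :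
    PreservesColimit (Discrete.functor Y) F := by
  classical
  have h := isColimitOfPreserves F
    (CoproductsFromFiniteFiltered.isColimitFiniteSubproductsCocone Y)
  have fin (A : Finset (Discrete S)) : PreservesColimitsOfShape (Discrete A) F := inferInstance
  let hA (A : Finset (Discrete S)) :=
    isColimitOfPreserves F (coproductIsCoproduct fun a : A => Y a.1.as)
  let inc (A : Finset (Discrete S)) : (∐ fun a : A => Y a.1.as) ⟶ ∐ Y :=
    Sigma.desc fun a => Sigma.ι Y a.1.as
  have hinc (A : Finset (Discrete S)) (a : A) :
      F.map (Sigma.ι (fun a : A => Y a.1.as) a) ≫ F.map (inc A) = F.map (Sigma.ι Y a.1.as) := by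
    rw [← F.map_comp, Sigma.ι_desc]
  have ext {Z : H} {p q : F.obj (∐ Y) ⟶ Z}
      (hpq : ∀ s, F.map (Sigma.ι Y s) ≫ p = F.map (Sigma.ι Y s) ≫ q) : p = q :=
    h.hom_ext fun A => (hA A).hom_ext fun ⟨a⟩ => by
      have := hpq a.1.as
      rw [← hinc A a, Category.assoc, Category.assoc] at this
      exact this
  refine preservesColimit_of_preserves_colimit_cocone (colimit.isColimit (Discrete.functor Y))
    (IsColimit.ofExistsUnique fun t => ?_)
  let tA (A : Finset (Discrete S)) : Cocone (Discrete.functor (fun a : A => Y a.1.as) ⋙ F) :=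
    { pt := t.pt, ι := Discrete.natTrans fun a => t.ι.app a.as.1 }
  let d (A : Finset (Discrete S)) : F.obj (∐ fun a : A => Y a.1.as) ⟶ t.pt := (hA A).desc (tA A)
  have hd (A : Finset (Discrete S)) (a : A) :
      F.map (Sigma.ι (fun a : A => Y a.1.as) a) ≫ d A = t.ι.app a.1 := (hA A).fac (tA A) ⟨a⟩
  let T : Cocone (CoproductsFromFiniteFiltered.liftToFinsetObj (Discrete.functor Y) ⋙ F) :=
    { pt := t.pt
      ι := { app := d
             naturality := fun A B f => (hA A).hom_ext fun ⟨a⟩ => by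
              have h₁ := hd A a
              have h₂ := hd B ⟨a.1, leOfHom f a.2⟩
              rw [← h₁] at h₂
              refine Eq.trans ?_ (h₂.trans (congr_arg _ (Category.comp_id (d A)).symm))
              have key : Sigma.ι (fun a : A => Y a.1.as) a ≫
                  (CoproductsFromFiniteFiltered.liftToFinsetObj (Discrete.functor Y)).map f =
                  Sigma.ι (fun a : B => Y a.1.as) ⟨a.1, leOfHom f a.2⟩ := Sigma.ι_desc _ _
              exact (F.map_comp_assoc _ _ _).symm.trans (congr_arg (F.map · ≫ d B) key) } }
  have hT (s : S) : F.map (Sigma.ι Y s) ≫ h.desc T = t.ι.app ⟨s⟩ := by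
    have h₁ := h.fac T {⟨s⟩}
    have h₂ := hd {⟨s⟩} ⟨⟨s⟩, by simp⟩
    rw [← hinc {⟨s⟩} ⟨⟨s⟩, by simp⟩, ← h₂]
    exact (Category.assoc _ _ _).trans (congr_arg _ h₁)
  exact ⟨h.desc T, fun ⟨s⟩ => hT s, fun m hm => ext fun s => (hm ⟨s⟩).trans (hT s).symm⟩

section

variable [MonoidalCategory G]

/-- The adjunction property of inner cohomomorphism objects. -/
lemma coev_desc (X Z : G) [(tensorRight Z).IsRightAdjoint] {Y : G} (f : X ⟶ Y ⊗ Z) :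
    ∃! e : cohom X Z ⟶ Y, coev X Z ≫ e ▷ Z = f := by
  let adj := Adjunction.ofIsRightAdjoint (tensorRight Z)
  have h (e : cohom X Z ⟶ Y) : coev X Z ≫ e ▷ Z = adj.homEquiv X Y e :=
    (adj.homEquiv_unit X Y e).symm
  refine ⟨(adj.homEquiv X Y).symm f, ?_, fun e he => ?_⟩
  · exact (h _).trans ((adj.homEquiv X Y).apply_symm_apply f)
  · exact (Equiv.eq_symm_apply _).2 ((h e).symm.trans he)

end

namespace IsIndCompletion

variable [MonoidalCategory H] {ι : G ⥤ H} (hι : IsIndCompletion ι)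

include hι

lemma exists_presentation (Y : H) : ∃ (J : Type v) (_ : SmallCategory J) (_ : IsFiltered J)
    (D : J ⥤ G) (c : D ⋙ ι ⟶ (Functor.const J).obj Y), Nonempty (IsColimit (Cocone.mk Y c)) := by
  obtain ⟨J, _, _, D, c, hc, ⟨e⟩⟩ := hι.exists_colimit Y
  exact ⟨J, _, ‹_›, D, (c.extend e.hom).ι, ⟨hc.ofIsoColimit (Cocone.ext e)⟩⟩

lemma ext_ground {X Y : H} {f g : X ⟶ Y} (h : ∀ (W : G) (x : ι.obj W ⟶ X), x ≫ f = x ≫ g) :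
    f = g := by
  obtain ⟨J, _, _, D, c, ⟨hc⟩⟩ := hι.exists_presentation X
  exact hc.hom_ext fun j => h _ _

lemma mono_of_ground [Preadditive H] {X Y : H} {f : X ⟶ Y}
    (h : ∀ (W : G) (x : ι.obj W ⟶ X), x ≫ f = 0 → x = 0) : Mono f := by
  refine Preadditive.mono_of_cancel_zero _ fun {Z} z hz => hι.ext_ground fun W x => ?_
  rw [comp_zero]
  exact h W _ (by rw [Category.assoc, hz, comp_zero])

/-- If `B` is a union of objects of the ground category, a morphism from such an object to `M ⊗ B`
only involves a subobject of `B` which belongs to the ground category. -/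
lemma fac_subobject (M : H) {B : H} (hB : IsUnionOfGround ι B) {W : G}
    (f : ι.obj W ⟶ M ⊗ B) : ∃ (Z : G) (z : ι.obj Z ⟶ B) (g : ι.obj W ⟶ M ⊗ ι.obj Z),
      Mono z ∧ g ≫ M ◁ z = f := by
  have := hι.presentable
  obtain ⟨I, _, _, D, c, ⟨hc⟩⟩ := hι.exists_presentation B
  have := hι.tensorLeft_preserves M
  obtain ⟨i, g, hg⟩ := IsFinitelyPresentable.exists_hom_of_isColimit
    (isColimitOfPreserves (tensorLeft M) hc) f
  obtain ⟨Z, g', z, hz, h⟩ := hB _ (c.app i)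
  refine ⟨Z, z, g ≫ M ◁ g', hz, ?_⟩
  rw [Category.assoc, ← whiskerLeft_comp, h]
  exact hg

/-- The ground category is closed under finite colimits in its ind-completion. -/
lemma preservesFiniteColimits_ground : PreservesFiniteColimits ι := by
  have := hι.full
  have := hι.faithful
  have := hι.presentable
  have : RepresentablyCoflat ι := ⟨fun Y => by
    obtain ⟨J, _, _, D, c, ⟨hc⟩⟩ := hι.exists_presentation Y
    have := overVertex_final ι hc
    exact IsFiltered.of_final (overVertex ι c)⟩
  exact preservesFiniteColimits_of_coflat ι

variable [HasColimits H] [HasFiniteColimits G] (F : H ⥤ H)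
  [PreservesFilteredColimitsOfSize.{v, v} F] [PreservesFiniteColimits (ι ⋙ F)]

/-- A functor on the ind-completion which preserves filtered colimits is right exact if its
restriction to the ground category is right exact. -/
lemma preservesFiniteColimits_of_ground : PreservesFiniteColimits F := by
  have := hι.full
  have := hι.faithful
  have := hι.presentable
  have := hι.preservesFiniteColimits_ground
  have h₁ {X Y : H} (f g : X ⟶ Y) : PreservesColimit (parallelPair f g) F := by
    obtain ⟨I, _, _, D, c, ⟨hc⟩⟩ := hι.exists_presentation X
    obtain ⟨J, _, _, D', c', ⟨hc'⟩⟩ := hι.exists_presentation Y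
    obtain ⟨K, _, _, D₁, D₂, φ, ψ, c₁, c₂, h₁, h₂, hf, hg⟩ :=
      exists_parallel_presentation ι hc hc' f g
    have := preserves_of_levelwise ι F (parallelPair φ ψ)
    let e₁ : colimit (D₁ ⋙ ι) ≅ X := (colimit.isColimit _).coconePointUniqueUpToIso h₁
    let e₂ : colimit (D₂ ⋙ ι) ≅ Y := (colimit.isColimit _).coconePointUniqueUpToIso h₂
    have he₁ (k) : colimit.ι (D₁ ⋙ ι) k ≫ e₁.hom = c₁.app k :=
      IsColimit.comp_coconePointUniqueUpToIso_hom (colimit.isColimit (D₁ ⋙ ι)) h₁ k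
    have he₂ (k) : colimit.ι (D₂ ⋙ ι) k ≫ e₂.hom = c₂.app k :=
      IsColimit.comp_coconePointUniqueUpToIso_hom (colimit.isColimit (D₂ ⋙ ι)) h₂ k
    refine preservesColimit_of_iso_diagram F (K₁ := parallelPair φ ψ ⋙
      (Functor.whiskeringRight K G H).obj ι ⋙ colim)
      (diagramIsoParallelPair _ ≪≫ parallelPair.ext e₁ e₂ ?_ ?_)
    · refine colimit.hom_ext fun k => ?_
      simp [he₂, reassoc_of% he₁, hf]
    · refine colimit.hom_ext fun k => ?_
      simp [he₂, reassoc_of% he₁, hg]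
  have h₂ (X Y : H) : PreservesColimit (pair X Y) F := by
    obtain ⟨I, _, _, D, c, ⟨hc⟩⟩ := hι.exists_presentation X
    obtain ⟨J, _, _, D', c', ⟨hc'⟩⟩ := hι.exists_presentation Y
    let T := pair (CategoryTheory.Prod.fst I J ⋙ D) (CategoryTheory.Prod.snd I J ⋙ D')
    have := preserves_of_levelwise ι F T
    let h₁ := (Functor.Final.isColimitWhiskerEquiv (CategoryTheory.Prod.fst I J) _).symm hc
    let h₂ := (Functor.Final.isColimitWhiskerEquiv (CategoryTheory.Prod.snd I J) _).symm hc'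
    exact preservesColimit_of_iso_diagram F (K₁ := T ⋙
      (Functor.whiskeringRight (I × J) G H).obj ι ⋙ colim)
      (diagramIsoPair _ ≪≫ mapPairIso ((colimit.isColimit _).coconePointUniqueUpToIso h₁)
        ((colimit.isColimit _).coconePointUniqueUpToIso h₂))
  have h₃ : PreservesColimitsOfShape WalkingParallelPair F :=
    ⟨fun {K} => preservesColimit_of_iso_diagram F (diagramIsoParallelPair K).symm⟩
  have h₄ : PreservesColimitsOfShape (Discrete WalkingPair) F :=
    ⟨fun {K} => preservesColimit_of_iso_diagram F (diagramIsoPair K).symm⟩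
  have h₅ : PreservesColimitsOfShape (Discrete PEmpty.{1}) F := by
    have := preservesColimit_of_preserves_colimit_cocone (F := F)
      (isColimitOfPreserves ι (colimit.isColimit (Functor.empty.{0} G)))
      (isColimitOfPreserves (ι ⋙ F) (colimit.isColimit (Functor.empty.{0} G)))
    exact ⟨fun {K} => preservesColimit_of_iso_diagram F
      (Functor.uniqueFromEmpty _ ≪≫ (Functor.uniqueFromEmpty _).symm : Functor.empty G ⋙ ι ≅ K)⟩
  have : PreservesFiniteCoproducts F :=
    ⟨fun n => PreservesFiniteCoproducts.of_preserves_binary_and_initial F (Fin n)⟩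
  exact preservesFiniteColimits_of_preservesCoequalizers_and_finiteCoproducts F

end IsIndCompletion

section

variable [MonoidalCategory H]

/-- The coevaluation morphism in the ind-completion. -/
noncomputable def IsIndCompletion.indCoev [MonoidalCategory G] (ι : G ⥤ H) [ι.Monoidal] (X Z : G)
    [(tensorRight Z).IsRightAdjoint] :
    ι.obj X ⟶ ι.obj (cohom X Z) ⊗ ι.obj Z :=
  ι.map (coev X Z) ≫ Functor.OplaxMonoidal.δ ι _ _

variable [BraidedCategory H] {ι : G ⥤ H} (hι : IsIndCompletion ι)

namespace IsIndCompletion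

include hι

lemma preservesFilteredColimits_tensorRight (Y : H) :
    PreservesFilteredColimitsOfSize.{v, v} (tensorRight Y) := by
  have := hι.tensorLeft_preserves Y
  exact ⟨fun J _ _ =>
    preservesColimitsOfShape_of_natIso (BraidedCategory.tensorLeftIsoTensorRight Y)⟩

variable [MonoidalCategory G] [ι.Monoidal]

/-- The adjunction property of inner cohomomorphism objects, extended to the ind-completion: both
sides commute with the filtered colimit `M`, as `cohom X Z` and `X` are finitely presentable. -/
lemma indCoev_desc (X Z : G) [(tensorRight Z).IsRightAdjoint] {M : H}
    (f : ι.obj X ⟶ M ⊗ ι.obj Z) :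
    ∃! e : ι.obj (cohom X Z) ⟶ M, indCoev ι X Z ≫ e ▷ ι.obj Z = f := by
  have := hι.full
  have := hι.faithful
  have := hι.presentable
  obtain ⟨I, _, _, D, c, ⟨hc⟩⟩ := hι.exists_presentation M
  have := hι.preservesFilteredColimits_tensorRight (ι.obj Z)
  have hcZ := isColimitOfPreserves (tensorRight (ι.obj Z)) hc
  have key {Y : G} (e : cohom X Z ⟶ Y) : indCoev ι X Z ≫ ι.map e ▷ ι.obj Z =
      ι.map (coev X Z ≫ e ▷ Z) ≫ Functor.OplaxMonoidal.δ ι _ _ := by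
    rw [indCoev, Category.assoc, Functor.OplaxMonoidal.δ_natural_left, Functor.map_comp,
      Category.assoc]
  refine existsUnique_of_exists_of_unique ?_ fun e e' he he' => ?_
  · obtain ⟨i, g, hg⟩ := IsFinitelyPresentable.exists_hom_of_isColimit hcZ f
    obtain ⟨g', hg'⟩ := ι.map_surjective (g ≫ Functor.LaxMonoidal.μ ι (D.obj i) Z)
    obtain ⟨e, he, -⟩ := coev_desc X Z g'
    refine ⟨ι.map e ≫ c.app i, ?_⟩
    rw [comp_whiskerRight, ← Category.assoc, key, he, hg', Category.assoc, Category.assoc,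
      Functor.Monoidal.μ_δ_assoc]
    exact hg
  · obtain ⟨i, g, rfl⟩ := IsFinitelyPresentable.exists_hom_of_isColimit hc e
    obtain ⟨i', g', rfl⟩ := IsFinitelyPresentable.exists_hom_of_isColimit hc e'
    obtain ⟨g, rfl⟩ := ι.map_surjective g
    obtain ⟨g', rfl⟩ := ι.map_surjective g'
    have hh : (indCoev ι X Z ≫ ι.map g ▷ ι.obj Z) ≫ c.app i ▷ ι.obj Z =
        (indCoev ι X Z ≫ ι.map g' ▷ ι.obj Z) ≫ c.app i' ▷ ι.obj Z := by
      rw [Category.assoc, Category.assoc, ← comp_whiskerRight, ← comp_whiskerRight]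
      exact he.trans he'.symm
    obtain ⟨k, p, q, hpq⟩ := IsFinitelyPresentable.exists_eq_of_isColimit hcZ _ _ hh
    have hpq' : indCoev ι X Z ≫ ι.map (g ≫ D.map p) ▷ ι.obj Z =
        indCoev ι X Z ≫ ι.map (g' ≫ D.map q) ▷ ι.obj Z := by
      simpa using hpq
    rw [key, key, cancel_mono] at hpq'
    have := (coev_desc X Z _).unique rfl (ι.map_injective hpq').symm
    have h₁ : ι.map (D.map p) ≫ c.app k = c.app i := by simpa using c.naturality p
    have h₂ : ι.map (D.map q) ≫ c.app k = c.app i' := by simpa using c.naturality q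
    change ι.map g ≫ c.app i = ι.map g' ≫ c.app i'
    rw [← h₁, ← h₂, ← Functor.map_comp_assoc, ← Functor.map_comp_assoc, this]

end IsIndCompletion

end

section

variable [MonoidalCategory G] [BraidedCategory G] [MonoidalCategory H] [BraidedCategory H]
  {ι : G ⥤ H} [ι.Monoidal] (hι : IsIndCompletion ι)
  [HasColimits H] [HasFiniteColimits G] [∀ X : G, PreservesFiniteColimits (tensorLeft X)]

namespace IsIndCompletion

include hι

lemma preservesFiniteColimits_tensorRight_ground (X : G) :
    PreservesFiniteColimits (tensorRight (ι.obj X)) := by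
  have := hι.preservesFilteredColimits_tensorRight (ι.obj X)
  have := hι.preservesFiniteColimits_ground
  let e : tensorLeft X ⋙ ι ≅ ι ⋙ tensorRight (ι.obj X) :=
    NatIso.ofComponents (fun Y => ι.mapIso (β_ X Y) ≪≫ (Functor.Monoidal.μIso ι Y X).symm)
      (fun {Y Z} f => by
        change ι.map (X ◁ f) ≫ ι.map (β_ X Z).hom ≫ Functor.OplaxMonoidal.δ ι Z X =
          (ι.map (β_ X Y).hom ≫ Functor.OplaxMonoidal.δ ι Y X) ≫ ι.map f ▷ ι.obj X
        rw [← Functor.map_comp_assoc, BraidedCategory.braiding_naturality_right, Category.assoc,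
          Functor.map_comp_assoc, Functor.OplaxMonoidal.δ_natural_left])
  have : PreservesFiniteColimits (ι ⋙ tensorRight (ι.obj X)) := preservesFiniteColimits_of_natIso e
  exact hι.preservesFiniteColimits_of_ground _

/-- Right exactness of the tensor product extends from the ground category in one argument after
the other. -/
lemma preservesFiniteColimits_tensorLeft (M : H) : PreservesFiniteColimits (tensorLeft M) := by
  have := hι.tensorLeft_preserves M
  have := hι.preservesFiniteColimits_ground
  have : PreservesFiniteColimits (ι ⋙ tensorLeft M) := by
    obtain ⟨J, _, _, D, c, ⟨hc⟩⟩ := hι.exists_presentation M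
    let Θ : G ⥤ J ⥤ H := ι ⋙ (curriedTensor H).flip ⋙ (Functor.whiskeringLeft J H H).obj (D ⋙ ι)
    have h₁ (j : J) : PreservesFiniteColimits (Θ ⋙ (evaluation J H).obj j) := by
      have h : PreservesFiniteColimits (tensorLeft (ι.obj (D.obj j))) := by
        have := hι.preservesFiniteColimits_tensorRight_ground (D.obj j)
        exact preservesFiniteColimits_of_natIso
          (BraidedCategory.tensorLeftIsoTensorRight (ι.obj (D.obj j))).symm
      exact inferInstanceAs (PreservesFiniteColimits (ι ⋙ tensorLeft (ι.obj (D.obj j))))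
    have h₂ : PreservesFiniteColimits Θ :=
      ⟨fun K _ _ => preservesColimitsOfShape_of_evaluation _ _ fun j => inferInstance⟩
    have hR := hι.preservesFilteredColimits_tensorRight
    let e : Θ ⋙ colim ≅ ι ⋙ tensorLeft M :=
      NatIso.ofComponents (fun W => (colimit.isColimit (Θ.obj W)).coconePointUniqueUpToIso
        (isColimitOfPreserves (tensorRight (ι.obj W)) hc)) (by
          intro W W' f
          refine colimit.hom_ext fun j => ?_
          have h (W : G) : colimit.ι (Θ.obj W) j ≫
              ((colimit.isColimit (Θ.obj W)).coconePointUniqueUpToIso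
                (isColimitOfPreserves (tensorRight (ι.obj W)) hc)).hom = c.app j ▷ ι.obj W :=
            IsColimit.comp_coconePointUniqueUpToIso_hom (colimit.isColimit (Θ.obj W)) _ j
          simp [h, reassoc_of% h W]
          simp [Θ, whisker_exchange])
    exact preservesFiniteColimits_of_natIso e
  exact hι.preservesFiniteColimits_of_ground _

lemma preservesFiniteColimits_tensorRight (M : H) : PreservesFiniteColimits (tensorRight M) := by
  have := hι.preservesFiniteColimits_tensorLeft M
  exact preservesFiniteColimits_of_natIso (BraidedCategory.tensorLeftIsoTensorRight M)

lemma preservesCoproduct_tensorLeft (M : H) {S : Type v} (Y : S → H) :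
    PreservesColimit (Discrete.functor Y) (tensorLeft M) := by
  have := hι.tensorLeft_preserves M
  have := hι.preservesFiniteColimits_tensorLeft M
  exact preservesCoproduct_of_finite_of_filtered _ _

lemma preservesColimitsOfShape_nat (M : H) :
    PreservesColimitsOfShape (Discrete ℕ) (tensorLeft M) := by
  have (K : Discrete (ULift.{v} ℕ) ⥤ H) : PreservesColimit K (tensorLeft M) :=
    have : PreservesColimit (Discrete.functor (K.obj ∘ Discrete.mk)) (tensorLeft M) :=
      hι.preservesCoproduct_tensorLeft M _
    preservesColimit_of_iso_diagram _ Discrete.natIsoFunctor.symm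
  have : PreservesColimitsOfShape (Discrete (ULift.{v} ℕ)) (tensorLeft M) := ⟨inferInstance⟩
  exact preservesColimitsOfShape_of_equiv (Discrete.equivalence Equiv.ulift) _

end IsIndCompletion

end

namespace IsIndCompletion

/-- Tensoring with an object of the ind-completion preserves the inclusion of a subobject which
belongs to the ground category: at a sufficiently late stage of the presentations of `M` and `B`,
this is a monomorphism of the ground category tensored with an object of the ground category. -/
lemma mono_whiskerLeft [Abelian G] [MonoidalCategory G]
    [∀ X : G, PreservesFiniteLimits (tensorLeft X)] [Abelian H] [MonoidalCategory H]
    [BraidedCategory H] {ι : G ⥤ H} [ι.Monoidal]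
    (hι : IsIndCompletion ι) (M : H) {Z : G} {B : H} (z : ι.obj Z ⟶ B) [Mono z] : Mono (M ◁ z) := by
  have := hι.full
  have := hι.faithful
  have := hι.presentable
  have := hι.preservesFiniteColimits_ground
  have : ι.PreservesZeroMorphisms := Functor.preservesZeroMorphisms_of_preserves_initial_object
  refine hι.mono_of_ground fun W x hx => ?_
  obtain ⟨I, _, _, D, c, ⟨hc⟩⟩ := hι.exists_presentation M
  obtain ⟨J, _, _, D', c', ⟨hc'⟩⟩ := hι.exists_presentation B
  have (Y : H) := hι.preservesFilteredColimits_tensorRight Y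
  have (Y : H) := hι.tensorLeft_preserves Y
  obtain ⟨i, y, rfl⟩ := IsFinitelyPresentable.exists_hom_of_isColimit
    (isColimitOfPreserves (tensorRight (ι.obj Z)) hc) x
  have h₁ : (y ≫ ι.obj (D.obj i) ◁ z) ≫ c.app i ▷ B = 0 ≫ c.app i ▷ B := by
    rw [zero_comp, Category.assoc, whisker_exchange, ← hx, Category.assoc]
    rfl
  obtain ⟨i', a, b, h₂⟩ := IsFinitelyPresentable.exists_eq_of_isColimit
    (isColimitOfPreserves (tensorRight B) hc) _ _ h₁
  obtain ⟨k, z', hz'⟩ := IsFinitelyPresentable.exists_hom_of_isColimit hc' z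
  change z' ≫ c'.app k = z at hz'
  have h₃ : (y ≫ ι.map (D.map a) ▷ ι.obj Z ≫ ι.obj (D.obj i') ◁ z') ≫
      ι.obj (D.obj i') ◁ c'.app k = 0 ≫ ι.obj (D.obj i') ◁ c'.app k := by
    rw [zero_comp]
    refine Eq.trans ?_ (h₂.trans zero_comp)
    change _ = (y ≫ _) ≫ ι.map (D.map a) ▷ B
    rw [Category.assoc, Category.assoc, Category.assoc, ← whiskerLeft_comp, hz', whisker_exchange]
  obtain ⟨k', p, q, h₄⟩ := IsFinitelyPresentable.exists_eq_of_isColimit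
    (isColimitOfPreserves (tensorLeft (ι.obj (D.obj i'))) hc') _ _ h₃
  let t : Z ⟶ D'.obj k' := ι.preimage z' ≫ D'.map p
  have ht : ι.map t ≫ c'.app k' = z := by
    have := c'.naturality p
    simp only [Functor.comp_map, Functor.const_obj_map] at this
    simp [t, this, hz']
  have : Mono (ι.map t) := mono_of_mono_fac ht
  have : Mono t := ι.mono_of_mono_map this
  have : Mono (D.obj i' ◁ t) := inferInstanceAs (Mono ((tensorLeft (D.obj i')).map t))
  have h₅ : y ≫ ι.map (D.map a) ▷ ι.obj Z ≫ ι.obj (D.obj i') ◁ ι.map t = 0 := by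
    have h₆ : y ≫ ι.map (D.map a) ▷ ι.obj Z ≫ ι.obj (D.obj i') ◁ z' ≫
      ι.obj (D.obj i') ◁ ι.map (D'.map p) = 0 := by
      simpa using h₄.trans zero_comp
    simpa [t] using h₆
  have h₆ : y ≫ ι.map (D.map a) ▷ ι.obj Z = 0 := by
    obtain ⟨y', hy'⟩ := ι.map_surjective
      (y ≫ ι.map (D.map a) ▷ ι.obj Z ≫ Functor.LaxMonoidal.μ ι (D.obj i') Z)
    have hy'' : ι.map y' ≫ Functor.OplaxMonoidal.δ ι (D.obj i') Z =
        y ≫ ι.map (D.map a) ▷ ι.obj Z := by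
      rw [hy', Category.assoc, Category.assoc, Functor.Monoidal.μ_δ, Category.comp_id]
    have : y' ≫ D.obj i' ◁ t = 0 := by
      apply ι.map_injective
      rw [← cancel_mono (Functor.OplaxMonoidal.δ ι _ _), Functor.map_comp, Category.assoc,
        ← Functor.OplaxMonoidal.δ_natural_right, reassoc_of% hy'', h₅, ι.map_zero, zero_comp]
    have : y' = 0 := by rwa [← cancel_mono (D.obj i' ◁ t), zero_comp]
    rw [← hy'', this, ι.map_zero, zero_comp]
  have hc'' : ι.map (D.map a) ≫ c.app i' = c.app i := by
    have := c.naturality a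
    simpa using this
  change y ≫ c.app i ▷ ι.obj Z = 0
  rw [← hc'', comp_whiskerRight, reassoc_of% h₆, zero_comp]

end IsIndCompletion

end

/-! ### Coproducts, epimorphisms and the tensor product -/

section

variable {C : Type u₁} [Category.{v} C] [MonoidalCategory C]

lemma exists_whiskerLeft_sigma_desc (M : C) {S : Type*} (Y : S → C) [HasCoproduct Y]
    [PreservesColimit (Discrete.functor Y) (tensorLeft M)] {Z : C} (g : ∀ s, M ⊗ Y s ⟶ Z) :
    ∃ h : M ⊗ ∐ Y ⟶ Z, ∀ s, M ◁ Sigma.ι Y s ≫ h = g s :=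
  ⟨(isColimitOfPreserves (tensorLeft M) (colimit.isColimit (Discrete.functor Y))).desc
      { pt := Z, ι := Discrete.natTrans fun s => g s.as }, fun s =>
    (isColimitOfPreserves (tensorLeft M) (colimit.isColimit (Discrete.functor Y))).fac _ ⟨s⟩⟩

lemma whiskerLeft_sigma_hom_ext (M : C) {S : Type*} (Y : S → C) [HasCoproduct Y]
    [PreservesColimit (Discrete.functor Y) (tensorLeft M)] {Z : C} {g h : M ⊗ ∐ Y ⟶ Z}
    (e : ∀ s, M ◁ Sigma.ι Y s ≫ g = M ◁ Sigma.ι Y s ≫ h) : g = h :=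
  (isColimitOfPreserves (tensorLeft M) (colimit.isColimit (Discrete.functor Y))).hom_ext
    fun s => e s.as

lemma epi_whiskerLeft [∀ M : C, (tensorLeft M).PreservesEpimorphisms] (M : C) {X Y : C}
    (f : X ⟶ Y) [Epi f] : Epi (M ◁ f) :=
  inferInstanceAs (Epi ((tensorLeft M).map f))

/-! ### Words: tensor products with two kinds of factors -/

/-- Words of length `n` in two letters. They index tensor products of `n` factors, each of which is
one of two given objects. -/
inductive Word : ℕ → Type
  | nil : Word 0
  | gen {n : ℕ} : Word n → Word (n + 1)
  | elt {n : ℕ} : Word n → Word (n + 1)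

namespace Word

/-- The number of letters `elt`. -/
def count : {n : ℕ} → Word n → ℕ
  | _, nil => 0
  | _, gen w => count w
  | _, elt w => count w + 1

/-- The tensor product in which the letters `gen` and `elt` are replaced by `V` and `T`. -/
@[reducible] def obj (V T : C) : {n : ℕ} → Word n → C
  | _, nil => 𝟙_ C
  | _, gen w => obj V T w ⊗ V
  | _, elt w => obj V T w ⊗ T

/-- The morphism to a tensor power given by morphisms on the letters. -/
def map {V T X : C} (f : V ⟶ X) (g : T ⟶ X) : {n : ℕ} → (w : Word n) → (w.obj V T ⟶ tpow X n)
  | _, nil => 𝟙 (𝟙_ C)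
  | _, gen w => map f g w ⊗ₘ f
  | _, elt w => map f g w ⊗ₘ g

/-- The word `w` followed by `k` letters `gen`. -/
def append {n : ℕ} (w : Word n) : (k : ℕ) → Word (n + k)
  | 0 => w
  | k + 1 => gen (append w k)

lemma count_append {n : ℕ} (w : Word n) : ∀ k : ℕ, (w.append k).count = w.count
  | 0 => rfl
  | k + 1 => count_append w k

/-- The rebracketing which compares `append` with the tensor product. -/
def appendHom (V T : C) {n : ℕ} (w : Word n) :
    (k : ℕ) → (w.obj V T ⊗ tpow V k ⟶ (w.append k).obj V T)
  | 0 => (ρ_ _).hom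
  | k + 1 => (α_ _ _ _).inv ≫ appendHom V T w k ▷ V

lemma appendHom_map {V T X : C} (f : V ⟶ X) (g : T ⟶ X) {n : ℕ} (w : Word n) : ∀ k : ℕ,
    w.appendHom V T k ≫ (w.append k).map f g =
      (w.map f g ⊗ₘ tpowMap f k) ≫ (tpowAdd X n k).inv
  | 0 => by
    change (ρ_ _).hom ≫ w.map f g = (w.map f g ⊗ₘ 𝟙 (𝟙_ C)) ≫ (ρ_ (tpow X n)).hom
    rw [tensorHom_id, rightUnitor_naturality]
  | k + 1 => by
    have h := appendHom_map f g w k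
    change ((α_ _ _ _).inv ≫ appendHom V T w k ▷ V) ≫ ((w.append k).map f g ⊗ₘ f) =
      (w.map f g ⊗ₘ (tpowMap f k ⊗ₘ f)) ≫ (α_ _ _ _).inv ≫ (tpowAdd X n k).inv ▷ X
    rw [Category.assoc, ← tensorHom_id, tensorHom_comp_tensorHom, h,
      associator_inv_naturality_assoc, ← tensorHom_id, tensorHom_comp_tensorHom,
      Category.id_comp, Category.comp_id]

/-- A word without the letter `elt` gives a tensor power. -/
lemma exists_hom_tpow (V T : C) {n : ℕ} (w : Word n) (h : w.count = 0) :
    ∃ s : w.obj V T ⟶ tpow V n, ∀ {X : C} (f : V ⟶ X) (g : T ⟶ X),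
      s ≫ tpowMap f n = w.map f g := by
  induction w with
  | nil => exact ⟨𝟙 _, fun _ _ => Category.id_comp _⟩
  | gen w ih =>
    obtain ⟨s, hs⟩ := ih h
    refine ⟨s ▷ V, fun f g => ?_⟩
    change s ▷ V ≫ (tpowMap f _ ⊗ₘ f) = (w.map f g ⊗ₘ f)
    rw [← tensorHom_id, tensorHom_comp_tensorHom, hs f g, Category.id_comp]
  | elt w => simp [count] at h

/-- A tensor power is given by the word which only consists of the letter `elt`. -/
lemma exists_tpow_hom (V T : C) : ∀ n : ℕ, ∃ (w : Word n) (s : tpow T n ⟶ w.obj V T),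
    ∀ {X : C} (f : V ⟶ X) (g : T ⟶ X), s ≫ w.map f g = tpowMap g n
  | 0 => ⟨nil, 𝟙 _, fun _ _ => Category.id_comp _⟩
  | n + 1 => by
    obtain ⟨w, s, hs⟩ := exists_tpow_hom V T n
    refine ⟨elt w, s ▷ T, fun f g => ?_⟩
    change s ▷ T ≫ (w.map f g ⊗ₘ g) = (tpowMap g n ⊗ₘ g)
    rw [← tensorHom_id, tensorHom_comp_tensorHom, hs f g, Category.id_comp]

end Word

end

section

variable {C : Type u₁} [Category.{v} C] [MonoidalCategory C] [SymmetricCategory C]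

lemma leftComm_leftComm (X Y Z : C) : leftComm X Y Z ≫ leftComm Y X Z = 𝟙 _ := by
  simp only [leftComm, Category.assoc, Iso.hom_inv_id_assoc]
  rw [← comp_whiskerRight_assoc, SymmetricCategory.symmetry, id_whiskerRight, Category.id_comp,
    Iso.inv_hom_id]

section

variable [∀ M : C, (tensorLeft M).PreservesEpimorphisms]

lemma epi_whiskerRight (M : C) {X Y : C} (f : X ⟶ Y) [Epi f] : Epi (f ▷ M) := by
  have := epi_whiskerLeft M f
  have h : f ▷ M = (β_ X M).hom ≫ M ◁ f ≫ (β_ M Y).hom := by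
    rw [BraidedCategory.braiding_naturality_right, SymmetricCategory.symmetry_assoc]
  rw [h]
  infer_instance

lemma epi_tpowMap {X Y : C} (f : X ⟶ Y) [Epi f] : ∀ n : ℕ, Epi (tpowMap f n)
  | 0 => inferInstanceAs (Epi (𝟙 _))
  | n + 1 => by
    have := epi_tpowMap f n
    have := epi_whiskerRight X (tpowMap f n)
    have := epi_whiskerLeft (tpow Y n) f
    change Epi (tpowMap f n ⊗ₘ f)
    rw [MonoidalCategory.tensorHom_def]
    infer_instance

end

/-- The composite of a sequence of exchanges of neighbouring factors. -/
def swapsHom (X : C) {n : ℕ} : List (Fin n) → (tpow X (n + 1) ⟶ tpow X (n + 1))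
  | [] => 𝟙 _
  | i :: l => tpowSwap X n i ≫ swapsHom X l

lemma swapsHom_append (X : C) {n : ℕ} (l l' : List (Fin n)) :
    swapsHom X (l ++ l') = swapsHom X l ≫ swapsHom X l' := by
  induction l with
  | nil => simp [swapsHom]
  | cons i l ih => simp [swapsHom, ih]

lemma swapsHom_castSucc (X : C) {n : ℕ} (l : List (Fin n)) :
    swapsHom X (l.map Fin.castSucc) = swapsHom X l ▷ X := by
  induction l with
  | nil => simp [swapsHom]
  | cons i l ih => simp [swapsHom, ih, tpowSwap_castSucc]

/-- Equivariance of the structure maps of algebras under all composites of exchanges of neighbours;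
the permutation of the inputs does not depend on the algebra. -/
lemma Alg.exists_equiv_swapsHom (P : Operad C) {n : ℕ} (l : List (Fin n)) :
    ∃ e : Fin (n + 1) ≃ Fin (n + 1), ∀ A : Alg P,
      P.map e ▷ tpow A.X (n + 1) ≫ A.act n = P.obj (Fin (n + 1)) ◁ swapsHom A.X l ≫ A.act n := by
  induction l with
  | nil => exact ⟨Equiv.refl _, fun A => by simp [swapsHom, P.map_refl]⟩
  | cons i l ih =>
    obtain ⟨e, he⟩ := ih
    refine ⟨e.trans (Equiv.swap i.castSucc i.succ), fun A => ?_⟩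
    rw [P.map_trans, comp_whiskerRight, Category.assoc, A.act_swap, ← whisker_exchange_assoc, he,
      swapsHom, whiskerLeft_comp_assoc]

namespace Word

/-- `w'` arises from `w` by a permutation of the letters, so that the corresponding morphisms to
tensor powers differ by a composite of exchanges of neighbours. -/
def Reorder (V T : C) {n : ℕ} (w w' : Word (n + 1)) : Prop :=
  ∃ (s : w.obj V T ⟶ w'.obj V T) (l : List (Fin n)), ∀ {X : C} (f : V ⟶ X) (g : T ⟶ X),
    s ≫ w'.map f g = w.map f g ≫ swapsHom X l

lemma Reorder.trans {V T : C} {n : ℕ} {w w' w'' : Word (n + 1)} (h : Reorder V T w w')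
    (h' : Reorder V T w' w'') : Reorder V T w w'' := by
  obtain ⟨s, l, hs⟩ := h
  obtain ⟨s', l', hs'⟩ := h'
  exact ⟨s ≫ s', l ++ l', fun f g => by
    rw [Category.assoc, hs', reassoc_of% hs f g, swapsHom_append]⟩

lemma Reorder.gen {V T : C} {n : ℕ} {w w' : Word (n + 1)} (h : Reorder V T w w') :
    Reorder V T (gen w) (gen w') := by
  obtain ⟨s, l, hs⟩ := h
  refine ⟨s ▷ V, l.map Fin.castSucc, fun {X} f g => ?_⟩
  change s ▷ V ≫ (w'.map f g ⊗ₘ f) = (w.map f g ⊗ₘ f) ≫ _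
  rw [swapsHom_castSucc, ← tensorHom_id, ← tensorHom_id, tensorHom_comp_tensorHom,
    tensorHom_comp_tensorHom, hs, Category.id_comp, Category.comp_id]

lemma reorder_gen_elt (V T : C) {n : ℕ} (w : Word n) : Reorder V T (gen (elt w)) (elt (gen w)) := by
  refine ⟨(α_ _ _ _).hom ≫ _ ◁ (β_ _ _).hom ≫ (α_ _ _ _).inv, [Fin.last n], fun {X} f g => ?_⟩
  change _ ≫ ((w.map f g ⊗ₘ f) ⊗ₘ g) = ((w.map f g ⊗ₘ g) ⊗ₘ f) ≫ _ ≫ 𝟙 _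
  rw [tpowSwap_last, Category.comp_id, Category.assoc, Category.assoc, ← associator_inv_naturality,
    associator_naturality_assoc, whiskerLeft_comp_tensorHom_assoc,
    tensorHom_comp_whiskerLeft_assoc, BraidedCategory.braiding_naturality]

/-- A letter `elt` can be moved to the end of the word. -/
lemma exists_reorder_elt (V T : C) {n : ℕ} (w : Word (n + 1)) :
    w.count = 0 ∨ ∃ u : Word n, Reorder V T w (elt u) ∧ u.count + 1 = w.count := by
  induction n with
  | zero =>
    cases w with
    | gen u => cases u; exact Or.inl rfl
    | elt u => exact Or.inr ⟨u, ⟨𝟙 _, [], by simp [swapsHom]⟩, rfl⟩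
  | succ n ih =>
    cases w with
    | gen u =>
      refine (ih u).imp id ?_
      rintro ⟨u', h, hu⟩
      exact ⟨gen u', h.gen.trans (reorder_gen_elt V T u'), hu⟩
    | elt u => exact Or.inr ⟨u, ⟨𝟙 _, [], by simp [swapsHom]⟩, rfl⟩

end Word

/-! ### Monomials in the generators of an algebra -/

variable [HasCountableCoproducts C]

/-- The coproduct of the objects `P(n) ⊗ V^{⊗n}`, `n ≥ 1`. The free algebra is its quotient by the
action of the symmetric groups. -/
noncomputable def preFree (P : Operad C) (V : C) : C :=
  ∐ fun n : ℕ => P.obj (Fin (n + 1)) ⊗ tpow V (n + 1)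

/-- The inclusion of a summand. -/
noncomputable def preFreeι (P : Operad C) (V : C) (n : ℕ) :
    P.obj (Fin (n + 1)) ⊗ tpow V (n + 1) ⟶ preFree P V :=
  Sigma.ι (fun n : ℕ => P.obj (Fin (n + 1)) ⊗ tpow V (n + 1)) n

/-- The morphism to an algebra which extends a morphism `V ⟶ A`. -/
noncomputable def preFreeDesc {P : Operad C} {V : C} (A : Alg P) (i : V ⟶ A.X) :
    preFree P V ⟶ A.X :=
  Sigma.desc fun n => P.obj (Fin (n + 1)) ◁ tpowMap i (n + 1) ≫ A.act n

lemma preFreeι_desc {P : Operad C} {V : C} (A : Alg P) (i : V ⟶ A.X) (n : ℕ) :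
    preFreeι P V n ≫ preFreeDesc A i = P.obj (Fin (n + 1)) ◁ tpowMap i (n + 1) ≫ A.act n :=
  Sigma.ι_desc _ _

lemma preFree_hom_ext {P : Operad C} {V Z : C} {f g : preFree P V ⟶ Z}
    (h : ∀ n, preFreeι P V n ≫ f = preFreeι P V n ≫ g) : f = g :=
  Sigma.hom_ext _ _ h

lemma preFreeDesc_comp {P : Operad C} {V : C} {A B : Alg P} (i : V ⟶ A.X) (f : A ⟶ B) :
    preFreeDesc A i ≫ Alg.Hom.hom f = preFreeDesc B (i ≫ Alg.Hom.hom f) :=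
  preFree_hom_ext fun n => by
    rw [← Category.assoc, preFreeι_desc, preFreeι_desc, Category.assoc, Alg.Hom.act_hom,
      tpowMap_comp, whiskerLeft_comp_assoc]

/-- The inclusion of the generators, by means of the unit of the operad. -/
noncomputable def preFreeUnit (P : Operad C) (V : C) : V ⟶ preFree P V :=
  (λ_ V).inv ≫ ((P.unit.hom ≫ P.map unitFin) ⊗ₘ (λ_ V).inv) ≫ preFreeι P V 0

lemma preFreeUnit_desc {P : Operad C} {V : C} (A : Alg P) (i : V ⟶ A.X) :
    preFreeUnit P V ≫ preFreeDesc A i = i := by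
  have h : (λ_ V).inv ≫ (𝟙 (𝟙_ C) ⊗ₘ i) = i ≫ (λ_ A.X).inv := by
    rw [id_tensorHom, leftUnitor_inv_naturality]
  rw [preFreeUnit, Category.assoc, Category.assoc, preFreeι_desc]
  change _ ≫ _ ≫ _ ◁ (𝟙 (𝟙_ C) ⊗ₘ i) ≫ _ = _
  rw [tensorHom_comp_whiskerLeft_assoc, h, ← Category.id_comp (_ ≫ P.map unitFin),
    ← tensorHom_comp_tensorHom_assoc, A.act_unit, reassoc_of% h]
  simp

lemma Alg.hom_ext_of_generators {P : Operad C} {V : C} {A B : Alg P} (i : V ⟶ A.X)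
    [Epi (preFreeDesc A i)] {f g : A ⟶ B}
    (h : i ≫ Alg.Hom.hom f = i ≫ Alg.Hom.hom g) : f = g := by
  refine Alg.Hom.ext ?_
  rw [← cancel_epi (preFreeDesc A i), preFreeDesc_comp, preFreeDesc_comp, h]

/-- The monomials generate the same subobject whether or not the action of the symmetric groups has
been divided out. -/
lemma epi_freeDesc_iff [HasFiniteColimits C] {P : Operad C} {V : C} (A : Alg P)
    (i : V ⟶ A.X) :
    Epi (freeDesc A i) ↔ Epi (preFreeDesc A i) := by
  let p (n : ℕ) : P.obj (Fin (n + 1)) ⊗ tpow V (n + 1) ⟶ freeDeg P V n := coequalizer.π _ _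
  have hp (n : ℕ) : Epi (p n) := coequalizer.π_epi
  let j (n : ℕ) : freeDeg P V n ⟶ freeObj P V := Sigma.ι (freeDeg P V) n
  have hj (n : ℕ) : p n ≫ j n ≫ freeDesc A i =
      P.obj (Fin (n + 1)) ◁ tpowMap i (n + 1) ≫ A.act n :=
    (congr_arg (p n ≫ ·) (Sigma.ι_desc _ _)).trans (coequalizer.π_desc _ _)
  let π : preFree P V ⟶ freeObj P V := Sigma.desc fun n => p n ≫ j n
  have hπ (n : ℕ) : preFreeι P V n ≫ π = p n ≫ j n := Sigma.ι_desc _ _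
  have : Epi π := ⟨fun f g e => Sigma.hom_ext _ _ fun n => (cancel_epi (p n)).1 (by
    have := congr(preFreeι P V n ≫ $e)
    rwa [reassoc_of% hπ n, reassoc_of% hπ n] at this)⟩
  have h : π ≫ freeDesc A i = preFreeDesc A i := preFree_hom_ext fun n => by
    rw [preFreeι_desc, reassoc_of% hπ n, hj]
  rw [← h]
  exact ⟨fun _ => epi_comp _ _, fun _ => epi_of_epi π _⟩

variable {P : Operad C} {V : C}

section

variable (M : C) [PreservesColimitsOfShape (Discrete ℕ) (tensorLeft M)] {Z : C}

lemma exists_whiskerLeft_preFree_desc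
    (g : ∀ n : ℕ, M ⊗ (P.obj (Fin (n + 1)) ⊗ tpow V (n + 1)) ⟶ Z) :
    ∃ h : M ⊗ preFree P V ⟶ Z, ∀ n, M ◁ preFreeι P V n ≫ h = g n :=
  exists_whiskerLeft_sigma_desc M (fun n : ℕ => P.obj (Fin (n + 1)) ⊗ tpow V (n + 1)) g

variable {M} in
lemma whiskerLeft_preFree_hom_ext {g h : M ⊗ preFree P V ⟶ Z}
    (e : ∀ n, M ◁ preFreeι P V n ≫ g = M ◁ preFreeι P V n ≫ h) : g = h :=
  whiskerLeft_sigma_hom_ext M (fun n : ℕ => P.obj (Fin (n + 1)) ⊗ tpow V (n + 1)) e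

end

/-- The multiplication by `P(n)` of words in generators and monomials lifts to `preFree P V`,
uniformly for all algebras generated by `V`. -/
def Word.Composable (P : Operad C) (V : C) {n : ℕ} (w : Word (n + 1)) : Prop :=
  ∃ g : P.obj (Fin (n + 1)) ⊗ w.obj V (preFree P V) ⟶ preFree P V, ∀ (A : Alg P) (i : V ⟶ A.X),
    g ≫ preFreeDesc A i = P.obj (Fin (n + 1)) ◁ w.map i (preFreeDesc A i) ≫ A.act n

namespace Word

lemma composable_of_count_eq_zero {n : ℕ} (w : Word (n + 1)) (h : w.count = 0) :
    Composable P V w := by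
  obtain ⟨s, hs⟩ := w.exists_hom_tpow V (preFree P V) h
  refine ⟨P.obj (Fin (n + 1)) ◁ s ≫ preFreeι P V n, fun A i => ?_⟩
  rw [Category.assoc, preFreeι_desc, ← hs i, whiskerLeft_comp_assoc]

lemma Reorder.composable {n : ℕ} {w w' : Word (n + 1)} (h : Reorder V (preFree P V) w w')
    (h' : Composable P V w') : Composable P V w := by
  obtain ⟨s, l, hs⟩ := h
  obtain ⟨g, hg⟩ := h'
  obtain ⟨e, he⟩ := Alg.exists_equiv_swapsHom P l
  refine ⟨P.map e.symm ▷ _ ≫ P.obj (Fin (n + 1)) ◁ s ≫ g, fun A i => ?_⟩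
  rw [Category.assoc, Category.assoc, hg, ← whiskerLeft_comp_assoc, hs, whiskerLeft_comp_assoc,
    ← he, whisker_exchange_assoc, ← comp_whiskerRight_assoc, ← P.map_trans, Equiv.symm_trans_self,
    P.map_refl, id_whiskerRight, Category.id_comp]

variable [∀ M : C, PreservesColimitsOfShape (Discrete ℕ) (tensorLeft M)]

/-- If the last letter of a word is a monomial, the composition of the operad at the last input
replaces this monomial by its factors. -/
lemma composable_elt {n : ℕ} (w : Word n)
    (h : ∀ k : ℕ, Composable P V (n := n + k) (w.append (k + 1))) :
    Composable P V (elt w) := by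
  choose g hg using h
  obtain ⟨g', hg'⟩ := exists_whiskerLeft_preFree_desc
    (P.obj (Fin (n + 1)) ⊗ w.obj V (preFree P V)) (fun k => (α_ _ _ _).hom ≫
      P.obj (Fin (n + 1)) ◁ leftComm _ (P.obj (Fin (k + 1))) (tpow V (k + 1)) ≫
      (α_ _ _ _).inv ≫ (P.compLast n k ⊗ₘ w.appendHom V (preFree P V) (k + 1)) ≫ g k)
  refine ⟨(α_ _ _ _).inv ≫ g', fun A i => ?_⟩
  rw [← cancel_epi (α_ (P.obj (Fin (n + 1))) (w.obj V (preFree P V)) (preFree P V)).hom,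
    Category.assoc, Iso.hom_inv_id_assoc]
  refine whiskerLeft_preFree_hom_ext fun k => ?_
  rw [reassoc_of% hg' k, hg]
  change _ = _ ◁ preFreeι P V k ≫ _ ≫ _ ◁ (w.map i (preFreeDesc A i) ⊗ₘ preFreeDesc A i) ≫ _
  rw [associator_naturality_right_assoc, ← whiskerLeft_comp_assoc, whiskerLeft_comp_tensorHom,
    preFreeι_desc]
  -- The isomorphism `tpowAdd`, with its source written as it occurs in `Alg.act_comp`.
  obtain ⟨a, ha, ha'⟩ : ∃ a : tpow A.X (n + k + 1) ≅ tpow A.X n ⊗ tpow A.X (k + 1),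
      (P.compLast n k ▷ tpow A.X (n + k + 1) ≫ A.act (n + k) =
        (α_ _ _ _).hom ≫ P.obj (Fin (n + 1)) ◁ (P.obj (Fin (k + 1)) ◁ a.hom ≫
          leftComm _ (tpow A.X n) _ ≫ tpow A.X n ◁ A.act k) ≫ A.act n) ∧
      w.appendHom V (preFree P V) (k + 1) ≫
        map (n := n + k + 1) i (preFreeDesc A i) (w.append (k + 1)) =
      (w.map i (preFreeDesc A i) ⊗ₘ tpowMap i (k + 1)) ≫ a.inv :=
    ⟨tpowAdd A.X n (k + 1), A.act_comp n k, appendHom_map i (preFreeDesc A i) w (k + 1)⟩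
  have h₁ : (P.compLast n k ⊗ₘ w.appendHom V (preFree P V) (k + 1)) ≫
      P.obj (Fin (n + k + 1)) ◁ (map (n := n + k + 1) i (preFreeDesc A i) (w.append (k + 1))) =
      (P.obj (Fin (n + 1)) ⊗ P.obj (Fin (k + 1))) ◁
        ((w.map i (preFreeDesc A i) ⊗ₘ tpowMap i (k + 1)) ≫ a.inv) ≫
        P.compLast n k ▷ tpow A.X (n + k + 1) := by
    rw [tensorHom_comp_whiskerLeft, ha', ← id_tensorHom, ← tensorHom_id, tensorHom_comp_tensorHom,
      Category.id_comp, Category.comp_id]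
  have h₂ : leftComm (w.obj V (preFree P V)) (P.obj (Fin (k + 1))) (tpow V (k + 1)) ≫
      P.obj (Fin (k + 1)) ◁ (w.map i (preFreeDesc A i) ⊗ₘ tpowMap i (k + 1)) ≫
      leftComm (P.obj (Fin (k + 1))) (tpow A.X n) (tpow A.X (k + 1)) ≫ tpow A.X n ◁ A.act k =
      (w.map i (preFreeDesc A i) ⊗ₘ (P.obj (Fin (k + 1)) ◁ tpowMap i (k + 1) ≫ A.act k)) := by
    rw [← id_tensorHom (P.obj (Fin (k + 1))), reassoc_of% leftComm_natural,
      reassoc_of% leftComm_leftComm, id_tensorHom, tensorHom_comp_whiskerLeft]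
  have h₃ : ((w.map i (preFreeDesc A i) ⊗ₘ tpowMap i (k + 1)) ≫ a.inv) ≫ a.hom =
      w.map i (preFreeDesc A i) ⊗ₘ tpowMap i (k + 1) := by
    rw [Category.assoc, Iso.inv_hom_id, Category.comp_id]
  rw [reassoc_of% h₁, ha, associator_naturality_right_assoc, Iso.inv_hom_id_assoc,
    ← whiskerLeft_comp_assoc, ← whiskerLeft_comp_assoc, ← h₂, ← h₃,
    whiskerLeft_comp (P.obj (Fin (k + 1))) (_ ≫ a.inv)]
  simp only [Category.assoc, Iso.inv_hom_id_assoc]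

/-- Every letter `elt` of a word is moved to the end by a permutation and decomposed there. -/
lemma composable {n : ℕ} (w : Word (n + 1)) : Composable P V w := by
  induction h : w.count generalizing n w with
  | zero => exact composable_of_count_eq_zero w h
  | succ m ih =>
    obtain h' | ⟨u, hu, hu'⟩ := w.exists_reorder_elt V (preFree P V)
    · omega
    · refine hu.composable (composable_elt u fun k => ih _ ?_)
      exact (u.count_append (k + 1)).trans (by omega)

end Word

variable [∀ M : C, PreservesColimitsOfShape (Discrete ℕ) (tensorLeft M)]

lemma exists_preFreeMul (P : Operad C) (V : C) (n : ℕ) :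
    ∃ g : P.obj (Fin (n + 1)) ⊗ tpow (preFree P V) (n + 1) ⟶ preFree P V,
      ∀ (A : Alg P) (i : V ⟶ A.X),
        g ≫ preFreeDesc A i =
          P.obj (Fin (n + 1)) ◁ tpowMap (preFreeDesc A i) (n + 1) ≫ A.act n := by
  obtain ⟨w, s, hs⟩ := Word.exists_tpow_hom V (preFree P V) (n + 1)
  obtain ⟨g, hg⟩ := w.composable (P := P)
  exact ⟨P.obj (Fin (n + 1)) ◁ s ≫ g, fun A i => by
    rw [Category.assoc, hg, ← hs i, whiskerLeft_comp_assoc]⟩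

/-- A lift to `preFree P V` of the structure maps of all algebras generated by `V`. No axiom of an
algebra is claimed for these operations on `preFree P V` itself. -/
noncomputable def preFreeMul (P : Operad C) (V : C) (n : ℕ) :
    P.obj (Fin (n + 1)) ⊗ tpow (preFree P V) (n + 1) ⟶ preFree P V :=
  (exists_preFreeMul P V n).choose

lemma preFreeMul_desc (A : Alg P) (i : V ⟶ A.X) (n : ℕ) :
    preFreeMul P V n ≫ preFreeDesc A i =
      P.obj (Fin (n + 1)) ◁ tpowMap (preFreeDesc A i) (n + 1) ≫ A.act n :=
  (exists_preFreeMul P V n).choose_spec A i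

variable [∀ M : C, (tensorLeft M).PreservesEpimorphisms]

/-- A morphism from an algebra `A` which is generated by `V` is a morphism of algebras if it is
compatible with the monomials in the generators. -/
def Alg.homOfGenerators {A B : Alg P} (i : V ⟶ A.X) [Epi (preFreeDesc A i)] (f : A.X ⟶ B.X)
    (h : preFreeDesc A i ≫ f = preFreeDesc B (i ≫ f)) : A ⟶ B where
  hom := f
  act_hom n := by
    have := epi_tpowMap (preFreeDesc A i) (n + 1)
    have := epi_whiskerLeft (P.obj (Fin (n + 1))) (tpowMap (preFreeDesc A i) (n + 1))
    rw [← cancel_epi (P.obj (Fin (n + 1)) ◁ tpowMap (preFreeDesc A i) (n + 1)),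
      ← reassoc_of% preFreeMul_desc A i, h, preFreeMul_desc, ← h, tpowMap_comp,
      whiskerLeft_comp_assoc]

end

/-! ### Quotients by ideals -/

section

variable {C : Type u₁} [Category.{v} C] [MonoidalCategory C]

namespace Word

instance : Countable (Σ n, Word n) := by
  let f : ∀ {n : ℕ}, Word n → List Bool := fun {n} w =>
    Word.rec (motive := fun _ _ => List Bool) [] (fun _ l => false :: l) (fun _ l => true :: l) w
  have hf : ∀ {n : ℕ} (w : Word n) {m : ℕ} (w' : Word m), f w = f w' →
      (⟨n, w⟩ : Σ n, Word n) = ⟨m, w'⟩ := by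
    intro n w
    induction w with
    | nil => intro m w' h; cases w' <;> simp_all [f]
    | gen w ih =>
      intro m w' h
      cases w' with
      | nil => simp [f] at h
      | elt w' => simp [f] at h
      | gen w' =>
        cases ih w' (by simpa [f] using h)
        rfl
    | elt w ih =>
      intro m w' h
      cases w' with
      | nil => simp [f] at h
      | gen w' => simp [f] at h
      | elt w' =>
        cases ih w' (by simpa [f] using h)
        rfl
  exact Function.Injective.countable (f := fun w : Σ n, Word n => f w.2) fun w w' h => hf _ _ h

/-- The words of positive length with exactly one letter `elt`. They are the shapes of the arguments
of operations which have one argument in a given ideal. -/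
abbrev Pointed : Type := Σ n, {w : Word (n + 1) // w.count = 1}

instance : Countable Pointed :=
  Function.Injective.countable (β := Σ n, Word n) (f := fun w => ⟨w.1 + 1, w.2.1⟩) (by
    rintro ⟨n, w, hw⟩ ⟨m, w', hw'⟩ h
    cases h
    rfl)

/-- Functoriality of `Word.obj` in the object which replaces the letter `elt`. -/
def lift (V : C) {T T' : C} (t : T ⟶ T') : {n : ℕ} → (w : Word n) → (w.obj V T ⟶ w.obj V T')
  | _, nil => 𝟙 (𝟙_ C)
  | _, gen w => lift V t w ▷ V
  | _, elt w => lift V t w ⊗ₘ t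

lemma lift_map {V T T' X : C} (t : T ⟶ T') (f : V ⟶ X) (g : T' ⟶ X) {n : ℕ} (w : Word n) :
    w.lift V t ≫ w.map f g = w.map f (t ≫ g) := by
  induction w with
  | nil => exact Category.id_comp _
  | gen w ih =>
    change w.lift V t ▷ V ≫ (w.map f g ⊗ₘ f) = (w.map f (t ≫ g) ⊗ₘ f)
    rw [← tensorHom_id, tensorHom_comp_tensorHom, ih, Category.id_comp]
  | elt w ih =>
    change (w.lift V t ⊗ₘ t) ≫ (w.map f g ⊗ₘ g) = (w.map f (t ≫ g) ⊗ₘ (t ≫ g))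
    rw [tensorHom_comp_tensorHom, ih]

lemma map_tpowMap {V T X Y : C} (f : V ⟶ X) (g : T ⟶ X) (h : X ⟶ Y) {n : ℕ} (w : Word n) :
    w.map f g ≫ tpowMap h n = w.map (f ≫ h) (g ≫ h) := by
  induction w with
  | nil => exact Category.id_comp _
  | gen w ih =>
    change (w.map f g ⊗ₘ f) ≫ (tpowMap h _ ⊗ₘ h) = _
    rw [tensorHom_comp_tensorHom, ih]
    rfl
  | elt w ih =>
    change (w.map f g ⊗ₘ g) ≫ (tpowMap h _ ⊗ₘ h) = _
    rw [tensorHom_comp_tensorHom, ih]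
    rfl

lemma isIso_lift (V : C) {T T' : C} (t : T ⟶ T') {n : ℕ} (w : Word n) (h : w.count = 0) :
    IsIso (w.lift V t) := by
  induction w with
  | nil => exact inferInstanceAs (IsIso (𝟙 _))
  | gen w ih =>
    have := ih h
    exact inferInstanceAs (IsIso (w.lift V t ▷ V))
  | elt w => simp [count] at h

/-- A tensor power is given by the word which only consists of the letter `gen`. -/
lemma exists_count_eq_zero (V T : C) : ∀ n : ℕ, ∃ (w : Word n) (s : tpow V n ⟶ w.obj V T),
    w.count = 0 ∧ ∀ {X : C} (f : V ⟶ X) (g : T ⟶ X), s ≫ w.map f g = tpowMap f n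
  | 0 => ⟨nil, 𝟙 _, rfl, fun _ _ => Category.id_comp _⟩
  | n + 1 => by
    obtain ⟨w, s, hw, hs⟩ := exists_count_eq_zero V T n
    refine ⟨gen w, s ▷ V, hw, fun f g => ?_⟩
    change s ▷ V ≫ (w.map f g ⊗ₘ f) = (tpowMap f n ⊗ₘ f)
    rw [← tensorHom_id, tensorHom_comp_tensorHom, hs f g, Category.id_comp]

lemma map_zero [Preadditive C] [MonoidalPreadditive C] {V T X : C} (f : V ⟶ X) {n : ℕ} (w : Word n)
    (h : w.count ≠ 0) : w.map f (0 : T ⟶ X) = 0 := by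
  induction w with
  | nil => exact absurd rfl h
  | gen w ih =>
    change (w.map f 0 ⊗ₘ f) = 0
    rw [ih h, MonoidalCategory.tensorHom_def, MonoidalPreadditive.zero_whiskerRight, zero_comp]
  | elt w =>
    change (w.map f 0 ⊗ₘ 0) = 0
    rw [MonoidalCategory.tensorHom_def, MonoidalPreadditive.whiskerLeft_zero, comp_zero]

end Word

end

section

variable {C : Type u₁} [Category.{v} C] [MonoidalCategory C] [Abelian C]

lemma exists_whiskerLeft_cokernel_desc (M : C) [PreservesFiniteColimits (tensorLeft M)]
    {N Y Z : C} (r : N ⟶ Y) (h : M ⊗ Y ⟶ Z)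
    (hr : M ◁ r ≫ h = 0) : ∃ h' : M ⊗ cokernel r ⟶ Z, M ◁ cokernel.π r ≫ h' = h := by
  have hc := CokernelCofork.mapIsColimit _ (cokernelIsCokernel r) (tensorLeft M)
  exact ⟨hc.desc (CokernelCofork.ofπ h hr), hc.fac _ WalkingParallelPair.one⟩

variable [HasCountableCoproducts C] {O : ℕ → C} {Y R : C}
  (γ : ∀ n, O n ⊗ tpow Y (n + 1) ⟶ Y) (r : R ⟶ Y)

/-- Generators of the ideal generated by a morphism `r` to an object with operations `γ`. Step `k`
consists of the values of iterated operations of depth `k` on one argument from `r` and further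
arguments from `Y`. -/
noncomputable def idealStep : ℕ → Over Y
  | 0 => Over.mk r
  | k + 1 => Over.mk (Sigma.desc fun w : Word.Pointed =>
      O w.1 ◁ w.2.1.map (𝟙 Y) (idealStep k).hom ≫ γ w.1)

/-- The morphism whose image is the ideal generated by `r`. -/
noncomputable def idealHom : (∐ fun k => (idealStep γ r k).left) ⟶ Y :=
  Sigma.desc fun k => (idealStep γ r k).hom

lemma comp_cokernel_idealHom : r ≫ cokernel.π (idealHom γ r) = 0 := by
  have h : Sigma.ι (fun k => (idealStep γ r k).left) 0 ≫ idealHom γ r = r := Sigma.ι_desc _ _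
  have := congr($h ≫ cokernel.π (idealHom γ r))
  rw [Category.assoc, cokernel.condition, comp_zero] at this
  exact this.symm

/-- A morphism which respects the operations and vanishes on `r` vanishes on the ideal. -/
lemma idealHom_comp_eq_zero [MonoidalPreadditive C] {X : C}
    (b : ∀ n, O n ⊗ tpow X (n + 1) ⟶ X) (f : Y ⟶ X)
    (hf : ∀ n, γ n ≫ f = O n ◁ tpowMap f (n + 1) ≫ b n) (hr : r ≫ f = 0) :
    idealHom γ r ≫ f = 0 := by
  refine Sigma.hom_ext _ _ fun k => ?_
  rw [idealHom, Sigma.ι_desc_assoc, comp_zero]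
  induction k with
  | zero => exact hr
  | succ k ih =>
    refine Sigma.hom_ext _ _ fun w => ?_
    change Sigma.ι _ w ≫ Sigma.desc _ ≫ f = _
    rw [Sigma.ι_desc_assoc, Category.assoc, hf, ← whiskerLeft_comp_assoc, Word.map_tpowMap, ih,
      Word.map_zero _ _ (by rw [w.2.2]; exact one_ne_zero), MonoidalPreadditive.whiskerLeft_zero,
      zero_comp]
    exact comp_zero.symm

end

section

variable {C : Type u₁} [Category.{v} C] [MonoidalCategory C] [SymmetricCategory C]

/-- `M ⊗ (X ⊗ Y) ≅ (M ⊗ Y) ⊗ X`. -/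
def tensorRotate (M X Y : C) : M ⊗ (X ⊗ Y) ≅ (M ⊗ Y) ⊗ X :=
  whiskerLeftIso M (β_ X Y) ≪≫ (α_ M Y X).symm

lemma tensorRotate_natural {M M' X X' Y Y' : C} (m : M ⟶ M') (f : X ⟶ X') (g : Y ⟶ Y') :
    (m ⊗ₘ (f ⊗ₘ g)) ≫ (tensorRotate M' X' Y').hom =
      (tensorRotate M X Y).hom ≫ ((m ⊗ₘ g) ⊗ₘ f) := by
  simp only [tensorRotate, Iso.trans_hom, whiskerLeftIso_hom, Iso.symm_hom, Category.assoc]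
  rw [tensorHom_comp_whiskerLeft_assoc, BraidedCategory.braiding_naturality,
    ← whiskerLeft_comp_tensorHom_assoc, associator_inv_naturality]

lemma tensorRotate_inv_natural {M M' X X' Y Y' : C} (m : M ⟶ M') (f : X ⟶ X') (g : Y ⟶ Y') :
    ((m ⊗ₘ g) ⊗ₘ f) ≫ (tensorRotate M' X' Y').inv =
      (tensorRotate M X Y).inv ≫ (m ⊗ₘ (f ⊗ₘ g)) := by
  rw [Iso.comp_inv_eq, Category.assoc, tensorRotate_natural, Iso.inv_hom_id_assoc]

/-- The tensor product of a word with exactly one letter `elt` commutes with coproducts in this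
letter. -/
lemma Word.hom_ext_of_sigma {S : Type*} (Y : C) (N : S → C) [HasCoproduct N]
    [∀ M : C, PreservesColimit (Discrete.functor N) (tensorLeft M)] {n : ℕ} (w : Word n)
    (hw : w.count = 1) {M Z : C} {g h : M ⊗ w.obj Y (∐ N) ⟶ Z}
    (e : ∀ s, M ◁ w.lift Y (Sigma.ι N s) ≫ g = M ◁ w.lift Y (Sigma.ι N s) ≫ h) : g = h := by
  induction w generalizing M with
  | nil => simp [count] at hw
  | gen w ih =>
    rw [← cancel_epi (tensorRotate M (w.obj Y (∐ N)) Y).inv]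
    refine ih hw fun s => ?_
    have := congr((tensorRotate M (w.obj Y (N s)) Y).inv ≫ $(e s))
    change _ ≫ M ◁ (w.lift Y (Sigma.ι N s) ▷ Y) ≫ g =
      _ ≫ M ◁ (w.lift Y (Sigma.ι N s) ▷ Y) ≫ h at this
    rw [← id_tensorHom, ← tensorHom_id, ← Category.assoc, ← Category.assoc,
      ← tensorRotate_inv_natural] at this
    simpa using this
  | elt w =>
    rw [← cancel_epi (α_ M (w.obj Y (∐ N)) (∐ N)).hom]
    refine whiskerLeft_sigma_hom_ext _ _ fun s => ?_
    have h₁ := w.isIso_lift Y (Sigma.ι N s) (by simpa [count] using hw)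
    rw [← cancel_epi ((M ◁ w.lift Y (Sigma.ι N s)) ▷ N s), ← cancel_epi (α_ _ _ _).inv]
    have := e s
    change M ◁ (w.lift Y (Sigma.ι N s) ⊗ₘ Sigma.ι N s) ≫ g =
      M ◁ (w.lift Y (Sigma.ι N s) ⊗ₘ Sigma.ι N s) ≫ h at this
    rw [MonoidalCategory.tensorHom_def] at this
    simpa using this

variable [Abelian C]

/-- A morphism from `M ⊗ Y^{⊗n}` which vanishes if one of the factors `Y` is replaced by `N`
factors through `M ⊗ (Y/N)^{⊗n}`. -/
lemma exists_tpow_cokernel_desc [∀ M : C, PreservesFiniteColimits (tensorLeft M)] {N Y Z : C}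
    (r : N ⟶ Y) (n : ℕ) {M : C} (h : M ⊗ tpow Y n ⟶ Z)
    (hr : ∀ w : Word n, w.count = 1 → M ◁ w.map (𝟙 Y) r ≫ h = 0) :
    ∃ h' : M ⊗ tpow (cokernel r) n ⟶ Z, M ◁ tpowMap (cokernel.π r) n ≫ h' = h := by
  induction n generalizing M with
  | zero => exact ⟨h, by simp [tpowMap]⟩
  | succ n ih =>
    let q := cokernel.π r
    obtain ⟨w₀, s, hw₀, hs⟩ := Word.exists_count_eq_zero Y N n
    -- The last factor is divided by `N` first, the other ones by the induction hypothesis.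
    have h₀ : M ◁ (tpow Y n ◁ r) ≫ h = 0 := by
      have := congr(M ◁ (s ▷ N) ≫ $(hr (Word.elt w₀) (congr_arg (· + 1) hw₀)))
      change _ ≫ M ◁ (w₀.map (𝟙 Y) r ⊗ₘ r) ≫ h = _ at this
      rwa [← whiskerLeft_comp_assoc, ← tensorHom_id, tensorHom_comp_tensorHom, hs, tpowMap_id,
        Category.id_comp, id_tensorHom, comp_zero] at this
    obtain ⟨k, hk⟩ := exists_whiskerLeft_cokernel_desc (M ⊗ tpow Y n) r ((α_ _ _ _).hom ≫ h)
      (by rw [associator_naturality_right_assoc, h₀, comp_zero])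
    have hk' : M ◁ (tpow Y n ◁ q) ≫ (α_ _ _ _).inv ≫ k = h := by
      rw [associator_inv_naturality_right_assoc, hk, Iso.inv_hom_id_assoc]
    obtain ⟨h₂, hh₂⟩ := ih ((tensorRotate M (tpow Y n) (cokernel r)).inv ≫ (α_ _ _ _).inv ≫ k) (by
      intro w hw
      have := epi_whiskerLeft M q
      have := epi_whiskerRight (w.obj Y N) (M ◁ q)
      rw [← cancel_epi ((M ◁ q) ▷ w.obj Y N), comp_zero]
      have h₃ := congr((tensorRotate M (w.obj Y N) Y).inv ≫ $(hr (Word.gen w) hw))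
      change _ ≫ M ◁ (w.map (𝟙 Y) r ⊗ₘ 𝟙 Y) ≫ h = _ at h₃
      rw [← hk', comp_zero] at h₃
      rw [← h₃, ← MonoidalCategory.tensorHom_def_assoc, ← id_tensorHom,
        reassoc_of% tensorRotate_inv_natural, ← whiskerLeft_comp_assoc, ← id_tensorHom (tpow Y n),
        tensorHom_comp_tensorHom, Category.comp_id, Category.id_comp, id_tensorHom])
    refine ⟨(tensorRotate M (tpow (cokernel r) n) (cokernel r)).hom ≫ h₂, ?_⟩
    change M ◁ (tpowMap q n ⊗ₘ q) ≫ _ = h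
    rw [← id_tensorHom, reassoc_of% tensorRotate_natural,
      MonoidalCategory.tensorHom_def _ (tpowMap q n), Category.assoc, hh₂, ← tensorHom_id,
      reassoc_of% tensorRotate_inv_natural,
      Iso.hom_inv_id_assoc, id_tensorHom, id_tensorHom, hk']

variable [HasCountableCoproducts C] [∀ M : C, PreservesColimitsOfShape (Discrete ℕ) (tensorLeft M)]
  {O : ℕ → C} {Y R : C} (γ : ∀ n, O n ⊗ tpow Y (n + 1) ⟶ Y) (r : R ⟶ Y)

/-- The ideal is closed under the operations. -/
lemma word_map_idealHom {n : ℕ} (w : Word (n + 1)) (hw : w.count = 1) :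
    O n ◁ w.map (𝟙 Y) (idealHom γ r) ≫ γ n ≫ cokernel.π (idealHom γ r) = 0 := by
  refine w.hom_ext_of_sigma Y (fun k => (idealStep γ r k).left) hw fun k => ?_
  have h' : Sigma.ι (fun k => (idealStep γ r k).left) (k + 1) ≫ idealHom γ r =
      (idealStep γ r (k + 1)).hom := Sigma.ι_desc _ _
  obtain ⟨b, hb⟩ : ∃ b : O n ⊗ w.obj Y (idealStep γ r k).left ⟶ ∐ fun k => (idealStep γ r k).left,
      b ≫ idealHom γ r = O n ◁ w.map (𝟙 Y) (idealStep γ r k).hom ≫ γ n :=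
    ⟨Sigma.ι (fun w : Word.Pointed => O w.1 ⊗ w.2.1.obj Y (idealStep γ r k).left) ⟨n, w, hw⟩ ≫
      Sigma.ι (fun k => (idealStep γ r k).left) (k + 1), (Category.assoc _ _ _).trans
        ((congr_arg (Sigma.ι (fun w : Word.Pointed => O w.1 ⊗ w.2.1.obj Y (idealStep γ r k).left)
          ⟨n, w, hw⟩ ≫ ·) h').trans (Sigma.ι_desc _ _))⟩
  have h : Sigma.ι (fun k => (idealStep γ r k).left) k ≫ idealHom γ r =
      (idealStep γ r k).hom := Sigma.ι_desc _ _
  rw [comp_zero, ← whiskerLeft_comp_assoc, Word.lift_map, h, ← Category.assoc, ← hb,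
    Category.assoc, cokernel.condition, comp_zero]

/-- The operations descend to the quotient by the ideal generated by `r`. -/
lemma exists_cokernel_idealHom_act [∀ M : C, PreservesFiniteColimits (tensorLeft M)] (n : ℕ) :
    ∃ a : O n ⊗ tpow (cokernel (idealHom γ r)) (n + 1) ⟶ cokernel (idealHom γ r),
      O n ◁ tpowMap (cokernel.π (idealHom γ r)) (n + 1) ≫ a = γ n ≫ cokernel.π (idealHom γ r) :=
  exists_tpow_cokernel_desc _ _ _ fun w hw => word_map_idealHom γ r w hw

end

/-! ### Algebras with generators and relations -/

lemma tpowAdd_natural {C : Type u₁} [Category.{v} C] [MonoidalCategory C] {X Y : C} (f : X ⟶ Y)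
    (m : ℕ) : ∀ n : ℕ,
    tpowMap f (m + n) ≫ (tpowAdd Y m n).hom =
      (tpowAdd X m n).hom ≫ (tpowMap f m ⊗ₘ tpowMap f n)
  | 0 => by
    change tpowMap f m ≫ (ρ_ (tpow Y m)).inv = (ρ_ (tpow X m)).inv ≫ (tpowMap f m ⊗ₘ 𝟙 (𝟙_ C))
    rw [tensorHom_id, rightUnitor_inv_naturality]
  | n + 1 => by
    have h := tpowAdd_natural f m n
    change (tpowMap f (m + n) ⊗ₘ f) ≫ (tpowAdd Y m n).hom ▷ Y ≫ (α_ _ _ _).hom =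
      ((tpowAdd X m n).hom ▷ X ≫ (α_ _ _ _).hom) ≫ (tpowMap f m ⊗ₘ (tpowMap f n ⊗ₘ f))
    rw [Category.assoc, ← associator_naturality, ← tensorHom_id, ← tensorHom_id,
      tensorHom_comp_tensorHom_assoc, tensorHom_comp_tensorHom_assoc, h, Category.id_comp,
      Category.comp_id]

section

variable {C : Type u₁} [Category.{v} C] [MonoidalCategory C] [SymmetricCategory C] [Preadditive C]
  {P : Operad C} {Y X : C} (γ : ∀ n, P.obj (Fin (n + 1)) ⊗ tpow Y (n + 1) ⟶ Y)
  (a : ∀ n, P.obj (Fin (n + 1)) ⊗ tpow X (n + 1) ⟶ X) (f : Y ⟶ X)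

/-- If a morphism `f` is compatible with operations `γ` and `a`, it is compatible with the defects
of equivariance of these operations. -/
lemma swap_comp_of_act
    (h : ∀ n, P.obj (Fin (n + 1)) ◁ tpowMap f (n + 1) ≫ a n = γ n ≫ f)
    (n : ℕ) (i : Fin n) :
    (P.map (Equiv.swap i.castSucc i.succ) ▷ tpow Y (n + 1) ≫ γ n -
      P.obj (Fin (n + 1)) ◁ tpowSwap Y n i ≫ γ n) ≫ f =
    P.obj (Fin (n + 1)) ◁ tpowMap f (n + 1) ≫
      (P.map (Equiv.swap i.castSucc i.succ) ▷ tpow X (n + 1) ≫ a n -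
        P.obj (Fin (n + 1)) ◁ tpowSwap X n i ≫ a n) := by
  rw [Preadditive.sub_comp, Preadditive.comp_sub, Category.assoc, Category.assoc, ← h,
    whisker_exchange_assoc, ← whiskerLeft_comp_assoc, ← whiskerLeft_comp_assoc, tpowSwap_natural]

/-- Compatibility with the defects of unitality, see `swap_comp_of_act`. -/
lemma unit_comp_of_act
    (h : ∀ n, P.obj (Fin (n + 1)) ◁ tpowMap f (n + 1) ≫ a n = γ n ≫ f) :
    (((P.unit.hom ≫ P.map unitFin) ⊗ₘ (λ_ Y).inv) ≫ γ 0 - (λ_ Y).hom) ≫ f =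
    (𝟙_ C) ◁ f ≫ (((P.unit.hom ≫ P.map unitFin) ⊗ₘ (λ_ X).inv) ≫ a 0 - (λ_ X).hom) := by
  rw [Preadditive.sub_comp, Preadditive.comp_sub, Category.assoc, ← h, leftUnitor_naturality]
  congr 1
  change _ ≫ _ ◁ (𝟙 (𝟙_ C) ⊗ₘ f) ≫ _ = _
  rw [tensorHom_comp_whiskerLeft_assoc, whiskerLeft_comp_tensorHom_assoc, id_tensorHom,
    leftUnitor_inv_naturality]

/-- Compatibility with the defects of composition, see `swap_comp_of_act`. -/
lemma comp_comp_of_act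
    (h : ∀ n, P.obj (Fin (n + 1)) ◁ tpowMap f (n + 1) ≫ a n = γ n ≫ f)
    (m n : ℕ) :
    (P.compLast m n ▷ tpow Y (m + n + 1) ≫ γ (m + n) -
        (α_ (P.obj (Fin (m + 1))) (P.obj (Fin (n + 1))) (tpow Y (m + n + 1))).hom ≫
        P.obj (Fin (m + 1)) ◁
          (P.obj (Fin (n + 1)) ◁ (tpowAdd Y m (n + 1)).hom ≫
            leftComm (P.obj (Fin (n + 1))) (tpow Y m) (tpow Y (n + 1)) ≫
            tpow Y m ◁ γ n) ≫ γ m) ≫ f =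
      (P.obj (Fin (m + 1)) ⊗ P.obj (Fin (n + 1))) ◁ tpowMap f (m + n + 1) ≫
      (P.compLast m n ▷ tpow X (m + n + 1) ≫ a (m + n) -
        (α_ (P.obj (Fin (m + 1))) (P.obj (Fin (n + 1))) (tpow X (m + n + 1))).hom ≫
        P.obj (Fin (m + 1)) ◁
          (P.obj (Fin (n + 1)) ◁ (tpowAdd X m (n + 1)).hom ≫
            leftComm (P.obj (Fin (n + 1))) (tpow X m) (tpow X (n + 1)) ≫
            tpow X m ◁ a n) ≫ a m) := by
  have h₁ : tpowMap f (m + n + 1) ≫ (tpowAdd X m (n + 1)).hom =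
      (tpowAdd Y m (n + 1)).hom ≫ (tpowMap f m ⊗ₘ tpowMap f (n + 1)) :=
    tpowAdd_natural f m (n + 1)
  have h₂ : (tpow Y m ◁ γ n) ≫ (tpowMap f m ⊗ₘ f) =
      (tpowMap f m ⊗ₘ (𝟙 (P.obj (Fin (n + 1))) ⊗ₘ tpowMap f (n + 1))) ≫ tpow X m ◁ a n := by
    rw [id_tensorHom, whiskerLeft_comp_tensorHom, tensorHom_comp_whiskerLeft, h]
  rw [Preadditive.sub_comp, Preadditive.comp_sub, Category.assoc, ← h, whisker_exchange_assoc]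
  congr 1
  simp only [Category.assoc]
  rw [← h, ← whiskerLeft_comp_assoc]
  change _ ≫ _ ◁ (_ ≫ (tpowMap f m ⊗ₘ f)) ≫ _ = _
  rw [associator_naturality_right_assoc, ← whiskerLeft_comp_assoc, Category.assoc, Category.assoc,
    h₂, ← whiskerLeft_comp_assoc, h₁, ← reassoc_of% leftComm_natural,
    id_tensorHom, whiskerLeft_comp_assoc (P.obj (Fin (n + 1)))]

end

section

variable {C : Type u₁} [Category.{v} C] [MonoidalCategory C] [SymmetricCategory C] [Abelian C]
  [HasColimits C] [∀ M : C, PreservesColimitsOfShape (Discrete ℕ) (tensorLeft M)]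

/-- The indices of the relations of an algebra with generators and relations: the three axioms
of an algebra, the identification of the monomials in the generators, and the given relations. -/
inductive RelIndex (J : Type v) : Type v
  | swap (n : ℕ) (i : Fin n)
  | unit
  | comp (m n : ℕ)
  | gen (n : ℕ)
  | given (j : J)

variable (P : Operad C) (V : C) {J : Type v} {R : J → C} (r : ∀ j, R j ⟶ preFree P V)

/-- The relations which make the quotient of `preFree P V` an algebra generated by `V` in which `r`
vanishes. The operations are those of `preFreeMul`, and the relations `gen` say that the classes of
the monomials are the monomials in the classes of the generators. -/
noncomputable def relation : RelIndex J → Over (preFree P V)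
  | .swap n i => Over.mk
      (P.map (Equiv.swap i.castSucc i.succ) ▷ tpow (preFree P V) (n + 1) ≫ preFreeMul P V n -
        P.obj (Fin (n + 1)) ◁ tpowSwap (preFree P V) n i ≫ preFreeMul P V n)
  | .unit => Over.mk
      (((P.unit.hom ≫ P.map unitFin) ⊗ₘ (λ_ (preFree P V)).inv) ≫ preFreeMul P V 0 -
        (λ_ (preFree P V)).hom)
  | .comp m n => Over.mk
      (P.compLast m n ▷ tpow (preFree P V) (m + n + 1) ≫ preFreeMul P V (m + n) -
        (α_ (P.obj (Fin (m + 1))) (P.obj (Fin (n + 1))) (tpow (preFree P V) (m + n + 1))).hom ≫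
        P.obj (Fin (m + 1)) ◁
          (P.obj (Fin (n + 1)) ◁ (tpowAdd (preFree P V) m (n + 1)).hom ≫
            leftComm (P.obj (Fin (n + 1))) (tpow (preFree P V) m) (tpow (preFree P V) (n + 1)) ≫
            tpow (preFree P V) m ◁ preFreeMul P V n) ≫
        preFreeMul P V m)
  | .gen n => Over.mk
      (preFreeι P V n -
        P.obj (Fin (n + 1)) ◁ tpowMap (preFreeUnit P V) (n + 1) ≫ preFreeMul P V n)
  | .given j => Over.mk (r j)

/-- All relations together. -/
noncomputable def relationHom : (∐ fun s => (relation P V r s).left) ⟶ preFree P V :=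
  Sigma.desc fun s => (relation P V r s).hom

variable {P V r}

lemma relationHom_comp_eq_zero_iff {Z : C} (f : preFree P V ⟶ Z) :
    relationHom P V r ≫ f = 0 ↔ ∀ s, (relation P V r s).hom ≫ f = 0 := by
  refine ⟨fun h s => ?_, fun h => Sigma.hom_ext _ _ fun s => ?_⟩
  · have := congr(Sigma.ι (fun s => (relation P V r s).left) s ≫ $h)
    rw [relationHom, Sigma.ι_desc_assoc, comp_zero] at this
    exact this
  · rw [relationHom, Sigma.ι_desc_assoc, comp_zero, h]

variable (P V r)

/-- The algebra with generators `V` and relations `r`. -/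
lemma exists_alg_generators_relations [MonoidalPreadditive C]
    [∀ M : C, PreservesFiniteColimits (tensorLeft M)] :
    ∃ (E : Alg P) (i : V ⟶ E.X), Epi (preFreeDesc E i) ∧ (∀ j, r j ≫ preFreeDesc E i = 0) ∧
      ∀ (X : Alg P) (e : V ⟶ X.X), (∀ j, r j ≫ preFreeDesc X e = 0) →
        ∃ f : E ⟶ X, i ≫ Alg.Hom.hom f = e := by
  let ρ := relationHom P V r
  let q := cokernel.π (idealHom (preFreeMul P V) ρ)
  have hq : ∀ s, (relation P V r s).hom ≫ q = 0 :=
    (relationHom_comp_eq_zero_iff q).1 (comp_cokernel_idealHom (preFreeMul P V) ρ)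
  choose a ha using exists_cokernel_idealHom_act (preFreeMul P V) ρ
  have := epi_tpowMap q
  have := fun (M : C) n => epi_whiskerLeft M (tpowMap q n)
  let E : Alg P :=
    { X := cokernel (idealHom (preFreeMul P V) ρ)
      act := a
      act_swap := fun n i => by
        rw [← sub_eq_zero, ← cancel_epi (P.obj (Fin (n + 1)) ◁ tpowMap q (n + 1)), comp_zero,
          ← swap_comp_of_act _ _ _ ha]
        exact hq (.swap n i)
      act_unit := by
        have := epi_whiskerLeft (𝟙_ C) q
        rw [← sub_eq_zero, ← cancel_epi ((𝟙_ C) ◁ q), comp_zero, ← unit_comp_of_act _ _ _ ha]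
        exact hq .unit
      act_comp := fun m n => by
        rw [← sub_eq_zero, ← cancel_epi
          ((P.obj (Fin (m + 1)) ⊗ P.obj (Fin (n + 1))) ◁ tpowMap q (m + n + 1)), comp_zero,
          ← comp_comp_of_act _ _ _ ha]
        exact hq (.comp m n) }
  have hE : preFreeDesc E (preFreeUnit P V ≫ q) = q := preFree_hom_ext fun n => by
    have : (preFreeι P V n - P.obj (Fin (n + 1)) ◁ tpowMap (preFreeUnit P V) (n + 1) ≫
      preFreeMul P V n) ≫ q = 0 := hq (.gen n)
    rw [Preadditive.sub_comp, sub_eq_zero, Category.assoc, ← ha] at this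
    rw [preFreeι_desc, this, tpowMap_comp, whiskerLeft_comp_assoc]
  have hE' : Epi (preFreeDesc E (preFreeUnit P V ≫ q)) := by
    rw [hE]
    infer_instance
  refine ⟨E, preFreeUnit P V ≫ q, hE', fun j => ?_, fun X e he => ?_⟩
  · rw [hE]
    exact hq (.given j)
  have h : ∀ n, P.obj (Fin (n + 1)) ◁ tpowMap (preFreeDesc X e) (n + 1) ≫ X.act n =
      preFreeMul P V n ≫ preFreeDesc X e := fun n => (preFreeMul_desc X e n).symm
  have hρ : ρ ≫ preFreeDesc X e = 0 := by
    refine (relationHom_comp_eq_zero_iff _).2 fun s => ?_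
    cases s with
    | swap n i =>
      exact (swap_comp_of_act _ _ _ h n i).trans (by rw [X.act_swap, sub_self]; exact comp_zero)
    | unit => exact (unit_comp_of_act _ _ _ h).trans (by rw [X.act_unit, sub_self]; exact comp_zero)
    | comp m n =>
      exact (comp_comp_of_act _ _ _ h m n).trans (by rw [X.act_comp, sub_self]; exact comp_zero)
    | gen n =>
      have : (preFreeι P V n - P.obj (Fin (n + 1)) ◁ tpowMap (preFreeUnit P V) (n + 1) ≫
          preFreeMul P V n) ≫ preFreeDesc X e = 0 := by
        rw [Preadditive.sub_comp, Category.assoc, preFreeMul_desc, ← whiskerLeft_comp_assoc,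
          ← tpowMap_comp, preFreeUnit_desc, preFreeι_desc, sub_self]
      exact this
    | given j => exact he j
  let f : E.X ⟶ X.X := cokernel.desc _ (preFreeDesc X e)
    (idealHom_comp_eq_zero _ _ X.act _ (fun n => (h n).symm) hρ)
  have hf : q ≫ f = preFreeDesc X e := cokernel.π_desc _ _ _
  have hf' : (preFreeUnit P V ≫ q) ≫ f = e := by rw [Category.assoc, hf, preFreeUnit_desc]
  exact ⟨Alg.homOfGenerators _ f (by rw [hE, hf, hf']), hf'⟩

end

/-! ### Morphisms to a tensor product of algebras -/

section

variable {C : Type u₁} [Category.{v} C] [MonoidalCategory C] [SymmetricCategory C]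
  {P : Operad C} (Δ : P.Comul)

section

variable [HasCountableCoproducts C] {V₁ V U : C} (c : V₁ ⟶ V ⊗ U) (B : Alg P) (b : U ⟶ B.X)

/-- The monomials in `V₁` are decomposed by a coaction `c : V₁ ⟶ V ⊗ U` and the comultiplication of
the operad, and the factors from `U` are multiplied in `B`. -/
noncomputable def preFreeTensor : preFree P V₁ ⟶ preFree P V ⊗ B.X :=
  Sigma.desc fun n => (Δ.app (Fin (n + 1)) ⊗ₘ (tpowMap c (n + 1) ≫ regroup V U (n + 1))) ≫
    tensorμ _ _ _ _ ≫ (preFreeι P V n ⊗ₘ (P.obj (Fin (n + 1)) ◁ tpowMap b (n + 1) ≫ B.act n))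

/-- For all algebras `X` and all `e : V ⟶ X`, the extension to monomials of the morphism
`V₁ ⟶ V ⊗ U ⟶ X ⊗ B` is obtained from `preFreeTensor`, which does not depend on `X`. -/
lemma preFreeTensor_desc (X : Alg P) (e : V ⟶ X.X) :
    preFreeTensor Δ c B b ≫ preFreeDesc X e ▷ B.X =
      preFreeDesc (Δ.tensor X B) (c ≫ (e ⊗ₘ b)) := by
  refine preFree_hom_ext fun n => ?_
  have h : preFreeι P V₁ n ≫ preFreeTensor Δ c B b = _ := Sigma.ι_desc _ _
  have h' : preFreeι P V₁ n ≫ preFreeDesc (Δ.tensor X B) (c ≫ (e ⊗ₘ b)) =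
      P.obj (Fin (n + 1)) ◁ (tpowMap c (n + 1) ≫ tpowMap (e ⊗ₘ b) (n + 1)) ≫
        (Δ.app (Fin (n + 1)) ⊗ₘ regroup X.X B.X (n + 1)) ≫ tensorμ _ _ _ _ ≫
          (X.act n ⊗ₘ B.act n) := by
    rw [← tpowMap_comp]
    exact preFreeι_desc (Δ.tensor X B) (c ≫ (e ⊗ₘ b)) n
  rw [reassoc_of% h, ← tensorHom_id, tensorHom_comp_tensorHom, preFreeι_desc,
    Category.comp_id, ← tensorHom_comp_tensorHom, ← tensorμ_natural_right_assoc,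
    tensorHom_comp_whiskerLeft_assoc, Category.assoc, ← regroup_natural]
  refine Eq.trans ?_ h'.symm
  rw [whiskerLeft_comp_tensorHom_assoc, Category.assoc]

end

/-- The morphisms from an algebra with generators `V` are given by the morphisms on `V` which
respect the relations between the generators. -/
lemma Alg.exists_hom_iff [Abelian C] [HasCountableCoproducts C]
    [∀ M : C, PreservesColimitsOfShape (Discrete ℕ) (tensorLeft M)]
    [∀ M : C, (tensorLeft M).PreservesEpimorphisms] {V : C} (A W : Alg P) (i : V ⟶ A.X)
    [Epi (preFreeDesc A i)] (j : V ⟶ W.X) :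
    (∃ u : A ⟶ W, i ≫ Alg.Hom.hom u = j) ↔
      kernel.ι (preFreeDesc A i) ≫ preFreeDesc W j = 0 := by
  constructor
  · rintro ⟨u, rfl⟩
    rw [← preFreeDesc_comp, kernel.condition_assoc, zero_comp]
  · intro h
    let f : A.X ⟶ W.X := Abelian.epiDesc (preFreeDesc A i) (preFreeDesc W j) h
    have hf : preFreeDesc A i ≫ f = preFreeDesc W j := Abelian.comp_epiDesc _ _ h
    have hi : i ≫ f = j := by
      rw [← preFreeUnit_desc A i, Category.assoc, hf, preFreeUnit_desc]
    exact ⟨Alg.homOfGenerators i f (by rw [hf, hi]), hi⟩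

end

/-! ### The inner cohomomorphism object -/

section

variable {G : Type u₁} [Category.{v} G] [Abelian G] [MonoidalCategory G] [SymmetricCategory G]
  [∀ X : G, PreservesFiniteColimits (tensorLeft X)]
  {H : Type u₂} [Category.{v} H] [Abelian H] [HasColimits H] [MonoidalCategory H]
  [SymmetricCategory H] {ι : G ⥤ H} [ι.Monoidal] (hι : IsIndCompletion ι)

namespace IsIndCompletion

include hι

lemma monoidalPreadditive : MonoidalPreadditive H := by
  have := hι.preservesFiniteColimits_tensorLeft
  have := hι.preservesFiniteColimits_tensorRight
  have (M : H) : PreservesBinaryBiproducts (tensorLeft M) :=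
    preservesBinaryBiproducts_of_preservesBinaryCoproducts _
  have (M : H) : PreservesBinaryBiproducts (tensorRight M) :=
    preservesBinaryBiproducts_of_preservesBinaryCoproducts _
  have (M : H) : (tensorLeft M).Additive := Functor.additive_of_preservesBinaryBiproducts _
  have (M : H) : (tensorRight M).Additive := Functor.additive_of_preservesBinaryBiproducts _
  exact
    { whiskerLeft_zero := fun {X Y Z} => (tensorLeft X).map_zero Y Z
      zero_whiskerRight := fun {X Y Z} => (tensorRight X).map_zero Y Z
      whiskerLeft_add := fun {X _ _} _ _ => (tensorLeft X).map_add
      add_whiskerRight := fun {X _ _} _ _ => (tensorRight X).map_add }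

variable [∀ X : G, PreservesFiniteLimits (tensorLeft X)] [∀ Z : G, (tensorRight Z).IsRightAdjoint]

/-- The coefficients with respect to `B` of a morphism to `Y ⊗ B`: a quotient of `Y` makes this
morphism vanish if and only if it makes its coefficients vanish. They are defined on inner
cohomomorphism objects of objects of the ground category. -/
lemma exists_coefficients {B : H} (hB : IsUnionOfGround ι B) {K Y : H} (k : K ⟶ Y ⊗ B) :
    ∃ (J : Type v) (R : J → H) (r : ∀ j, R j ⟶ Y), ∀ {X : H} (f : Y ⟶ X),
      (∀ j, r j ≫ f = 0) ↔ k ≫ f ▷ B = 0 := by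
  have := hι.monoidalPreadditive
  -- `K` is a colimit of objects `D j` of the ground category. The restriction of `k` to `D j`
  -- factors through some `Y ⊗ Z j` with `Z j` a subobject of `B`, and corresponds to a morphism
  -- from `cohom (D j) (Z j)` to `Y`.
  obtain ⟨J, _, _, D, c, ⟨hc⟩⟩ := hι.exists_presentation K
  choose Z z g hz hg using fun j => hι.fac_subobject Y hB (c.app j ≫ k)
  choose r hr hr' using fun j => hι.indCoev_desc (D.obj j) (Z j) (g j)
  refine ⟨J, fun j => ι.obj (cohom (D.obj j) (Z j)), r, fun {X} f => ?_⟩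
  have h (j : J) : r j ≫ f = 0 ↔ c.app j ≫ k ≫ f ▷ B = 0 := by
    have := hι.mono_whiskerLeft X (z j)
    have h₁ : r j ≫ f = 0 ↔ g j ≫ f ▷ ι.obj (Z j) = 0 := by
      refine ⟨fun h => ?_, fun h => ?_⟩
      · rw [← hr, Category.assoc, ← comp_whiskerRight, h, MonoidalPreadditive.zero_whiskerRight,
          comp_zero]
      · refine (hι.indCoev_desc (D.obj j) (Z j) 0).unique ?_ ?_
        · rw [comp_whiskerRight, reassoc_of% hr, h]
        · rw [MonoidalPreadditive.zero_whiskerRight, comp_zero]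
    rw [h₁, ← reassoc_of% hg, whisker_exchange, ← Category.assoc]
    exact ⟨fun h => by rw [h, zero_comp], fun h => (cancel_mono (X ◁ z j)).1 (by rw [h, zero_comp])⟩
  simp only [h]
  exact ⟨fun h => hc.hom_ext fun j => (h j).trans comp_zero.symm, fun h j => by rw [h, comp_zero]⟩

variable {P : Operad H} (Δ : P.Comul)

/-- The algebra with generators `cohom(A₁, B₁)` and the coefficients of the relations of `A` as
relations. It is universal among the algebras `X` with a morphism `e` for which the morphism
`A₁ ⟶ X ⊗ B` defined by `e` extends to a morphism of algebras on `A`. -/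
lemma exists_universal {A₁ B₁ : G} (A B : Alg P) (i : ι.obj A₁ ⟶ A.X) (b : ι.obj B₁ ⟶ B.X)
    (hA : Epi (freeDesc A i)) (hB : IsUnionOfGround ι B.X) :
    ∃ (E : Alg P) (i_E : ι.obj (cohom A₁ B₁) ⟶ E.X), Epi (freeDesc E i_E) ∧
      (∃ u : A ⟶ Δ.tensor E B, i ≫ Alg.Hom.hom u = indCoev ι A₁ B₁ ≫ (i_E ⊗ₘ b)) ∧
      ∀ (X : Alg P) (e : ι.obj (cohom A₁ B₁) ⟶ X.X),
        (∃ u : A ⟶ Δ.tensor X B, i ≫ Alg.Hom.hom u = indCoev ι A₁ B₁ ≫ (e ⊗ₘ b)) →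
        ∃ f : E ⟶ X, i_E ≫ Alg.Hom.hom f = e := by
  have := hι.monoidalPreadditive
  have := hι.preservesColimitsOfShape_nat
  have := hι.preservesFiniteColimits_tensorLeft
  have := (epi_freeDesc_iff A i).1 hA
  obtain ⟨J, R, r, hr⟩ := hι.exists_coefficients hB
    (kernel.ι (preFreeDesc A i) ≫ preFreeTensor Δ (indCoev ι A₁ B₁) B b)
  have h (X : Alg P) (e : ι.obj (cohom A₁ B₁) ⟶ X.X) :
      (∀ j, r j ≫ preFreeDesc X e = 0) ↔
        ∃ u : A ⟶ Δ.tensor X B, i ≫ Alg.Hom.hom u = indCoev ι A₁ B₁ ≫ (e ⊗ₘ b) := by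
    rw [hr, Category.assoc, preFreeTensor_desc]
    exact (Alg.exists_hom_iff A (Δ.tensor X B) i _).symm
  obtain ⟨E, i_E, hE, hE₁, hE₂⟩ := exists_alg_generators_relations P (ι.obj (cohom A₁ B₁)) r
  exact ⟨E, i_E, (epi_freeDesc_iff E i_E).2 hE, (h E i_E).1 hE₁,
    fun X e he => hE₂ X e ((h X e).2 he)⟩

end IsIndCompletion

end

end OperadCohom

open OperadCohom
theorem proposition2p6p2
    -- the ground category: abelian symmetric monoidal, exact tensor product, cohomomorphism objects
    {G : Type u₁} [Category.{v} G] [Abelian G] [MonoidalCategory G] [SymmetricCategory G]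
    [∀ X : G, PreservesFiniteLimits (tensorLeft X)]
    [∀ X : G, PreservesFiniteColimits (tensorLeft X)]
    [∀ X : G, PreservesFiniteLimits (tensorRight X)]
    [∀ X : G, PreservesFiniteColimits (tensorRight X)]
    [∀ Z : G, (tensorRight Z).IsRightAdjoint]
    -- the symmetric monoidal category `H = Ind(G)` of inductive limits
    {H : Type u₂} [Category.{v} H] [Abelian H] [HasColimits H] [MonoidalCategory H]
    [SymmetricCategory H] (ι : G ⥤ H) [ι.Braided] (hι : IsIndCompletion ι)
    -- an operad with symmetric comultiplication, and two algebras with presentation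
    (P : Operad H) (Δ : P.Comul) (A B : Presentation ι P)
    (hB : IsUnionOfGround ι B.alg.X) :
    ∃ (E : CohomDiagram Δ A B) (hE : IsInitial E)
      (i_E : ι.obj (cohom A.gen B.gen) ⟶ E.F.X) (hi : Epi (freeDesc E.F i_E)),
      (∀ E' : CohomDiagram Δ A B, Nonempty (IsInitial E') → Nonempty (Unique (E ≅ E'))) ∧
      E.u₁ = inducedGen ⟨cohom A.gen B.gen, E.F, i_E, hi⟩ (coev A.gen B.gen) ∧
      ∀ (F : Presentation ι P) (u : A.alg ⟶ Δ.tensor F.alg B.alg) (w : A.gen ⟶ F.gen ⊗ B.gen)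
        (h : A.incl ≫ Alg.Hom.hom u = inducedGen F w ≫ F.alg.X ◁ B.incl),
        ∃! φ : Presentation.Hom ⟨cohom A.gen B.gen, E.F, i_E, hi⟩ F,
          coev A.gen B.gen ≫ φ.gen ▷ B.gen = w ∧
          φ.alg = CohomDiagram.Hom.f (hE.to (⟨F.alg, u, inducedGen F w, h⟩ : CohomDiagram Δ A B)) := by
  have hA := (epi_freeDesc_iff A.alg A.incl).1 A.epi
  obtain ⟨E, i_E, hi, ⟨u, hu⟩, hE⟩ :=
    hι.exists_universal Δ A.alg B.alg A.incl B.incl A.epi hB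
  have hi' := (epi_freeDesc_iff E i_E).1 hi
  let c := IsIndCompletion.indCoev ι A.gen B.gen
  let E₀ : CohomDiagram Δ A B := ⟨E, u, c ≫ i_E ▷ ι.obj B.gen, by
    rw [hu, MonoidalCategory.tensorHom_def, Category.assoc]⟩
  -- For an object `D` of the category, `u₁` is the same as a morphism `e : cohom(A₁, B₁) ⟶ F`, and
  -- the existence of `u` is the condition under which `e` extends to `E`.
  have hE₀ (D : CohomDiagram Δ A B) : Nonempty (Unique (E₀ ⟶ D)) := by
    obtain ⟨e, he, he'⟩ := hι.indCoev_desc A.gen B.gen D.u₁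
    have hD : A.incl ≫ Alg.Hom.hom D.u = c ≫ (e ⊗ₘ B.incl) := by
      rw [D.comm, ← he, MonoidalCategory.tensorHom_def, Category.assoc]
    obtain ⟨f, hf⟩ := hE D.F e ⟨D.u, hD⟩
    refine ⟨⟨⟨f, Alg.hom_ext_of_generators A.incl ?_, ?_⟩⟩, fun g => ?_⟩
    · have hc : (c ≫ (i_E ⊗ₘ B.incl)) ≫ (Alg.Hom.hom f ⊗ₘ 𝟙 B.alg.X) = c ≫ (e ⊗ₘ B.incl) := by
        rw [Category.assoc, tensorHom_comp_tensorHom, hf, Category.comp_id]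
      rw [hD]
      exact (Category.assoc _ _ _).symm.trans
        ((congr_arg (· ≫ (Alg.Hom.hom f ⊗ₘ 𝟙 B.alg.X)) hu).trans hc)
    · change (c ≫ _) ≫ _ = _
      rw [Category.assoc, ← comp_whiskerRight, hf, he]
    · refine CohomDiagram.Hom.ext (Alg.hom_ext_of_generators i_E ?_)
      refine (he' _ ?_).trans hf.symm
      have := g.comm₁
      change (c ≫ _) ≫ _ = _ at this
      rwa [Category.assoc, ← comp_whiskerRight] at this
  have hE₁ (D : CohomDiagram Δ A B) : Unique (E₀ ⟶ D) := (hE₀ D).some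
  let hE₂ : IsInitial E₀ := IsInitial.ofUnique E₀
  refine ⟨E₀, hE₂, i_E, hi, ?_, Category.assoc _ _ _, ?_⟩
  · rintro E' ⟨hE'⟩
    exact ⟨⟨⟨hE₂.uniqueUpToIso hE'⟩, fun e => Iso.ext (hE₂.hom_ext _ _)⟩⟩
  · intro F u' w h
    obtain ⟨g, hg, hg'⟩ := coev_desc A.gen B.gen w
    have hF := (hE₂.to (⟨F.alg, u', inducedGen F w, h⟩ : CohomDiagram Δ A B)).comm₁
    change (c ≫ _) ≫ _ = inducedGen F w at hF
    refine ⟨⟨g, _, ?_⟩, ⟨hg, rfl⟩, ?_⟩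
    -- Both sides are the morphism on `cohom(A₁, B₁)` which corresponds to `inducedGen F w`.
    · refine (hι.indCoev_desc A.gen B.gen (inducedGen F w)).unique ?_ ?_
      · rwa [Category.assoc, ← comp_whiskerRight] at hF
      · rw [IsIndCompletion.indCoev, inducedGen, ← hg, comp_whiskerRight, Category.assoc,
          ι.map_comp, Category.assoc, Functor.OplaxMonoidal.δ_natural_left_assoc]
    · rintro ⟨g', a, ha⟩ ⟨h₁, h₂⟩
      obtain rfl := hg' g' h₁
      obtain rfl := h₂
      rfl
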